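/- **Setting.** Let $S,T$ be Bernoulli variables with joint probabilities $p_{ij}=P(S=i,T=j)$, $i,j\in\{0,1\}$, and put $q_1=p_{00}+p_{01}$, $q_2=p_{00}+p_{10}$ (the parameters of a bivariate Marshall–Olkin geometric distribution). Assume $p_{00},q_1,q_2\in(0,1)$ and $p_{00}\ge q_1q_2$. Let $n\ge 1$ be an integer and let $\gamma,\delta>0$. On $[-\log n,\infty)^2$ define $$\lambda^\star(s,t)=\begin{cases}\dfrac{\log(p_{00}/q_2)\log q_2}{\log^2(1/p_{00})}\,e^{-\frac{\log(p_{00}/q_2)}{\log p_{00}}s}\,e^{-\frac{\log q_2}{\log p_{00}}t}, & s<t,\\[2mm] \dfrac{\log(p_{00}/q_1)\log q_1}{\log^2(1/p_{00})}\,e^{-\frac{\log q_1}{\log p_{00}}s}\,e^{-\frac{\log(p_{00}/q_1)}{\log p_{00}}t}, & s>t,\end{cases}\qquad \acute\lambda^\star(s)=\frac{\log(p_{00}/(q_1q_2))}{\log(1/p_{00})}\,e^{-s},$$ $$\lambda^\star_{\gamma,\delta}(s,t)=\begin{cases}\dfrac{\gamma(1+\delta)}{(1+\gamma+\delta)^2}\,e^{-\frac{\gamma}{1+\gamma+\delta}s}\,e^{-\frac{1+\delta}{1+\gamma+\delta}t},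 & s<t,\\[2mm] \dfrac{\delta(1+\gamma)}{(1+\gamma+\delta)^2}\,e^{-\frac{1+\gamma}{1+\gamma+\delta}s}\,e^{-\frac{\delta}{1+\gamma+\delta}t}, & s>t,\end{cases}\qquad \acute\lambda^\star_{\gamma,\delta}(s)=\frac{1}{1+\gamma+\delta}\,e^{-s}.$$ For a Borel set $A^\star\subseteq[-\log n,\infty)^2$ let $$\boldsymbol\lambda^\star(B)=\iint_{A^\star\cap B}\lambda^\star(s,t)\,ds\,dt+\int_{\{s:\,(s,s)\in A^\star\cap B\}}\acute\lambda^\star(s)\,ds$$ for Borel $B\subseteq[-\log n,\infty)^2$, and let $\boldsymbol\lambda^\star_{\gamma,\delta}$ be defined in the same way from $\lambda^\star_{\gamma,\delta}$ and $\acute\lambda^\star_{\gamma,\delta}$. For a finite measure $\boldsymbol\lambda$, $\mathrm{PRM}(\boldsymbol\lambda)$ denotes the law of the Poisson process with mean measure $\boldsymbol\lambda$, a probability measure on the space $M_p$ of finite point measures on $[-\log n,\infty)^2$. **Distances.** $d_{TV}(\mu,\nu)=\sup_R|\mu(R)-\nu(R)|$ over measurable $R$. Let $d_0(z,w)=\min(1,|z-w|)$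 with $|\cdot|$ the Euclidean norm. For $\xi_1,\xi_2\in M_p$ let $d_1(\xi_1,\xi_2)=1$ if the numbers of points differ, $d_1(\xi_1,\xi_2)=0$ if both are zero, and otherwise, with $m$ the common number of points, $d_1(\xi_1,\xi_2)=\frac1m\sup_\kappa|\int\kappa\,d\xi_1-\int\kappa\,d\xi_2|$ over all real functions $\kappa$ that are $1$-Lipschitz with respect to $d_0$. For probability measures $\mu,\nu$ on $M_p$ let $d_2(\mu,\nu)=\sup_h|\int h\,d\mu-\int h\,d\nu|$ over all $h:M_p\to\mathbb R$ that are $1$-Lipschitz with respect to $d_1$. Write $|\boldsymbol\lambda^\star-\boldsymbol\lambda^\star_{\gamma,\delta}|$ for the variation measure of the signed measure $\boldsymbol\lambda^\star-\boldsymbol\lambda^\star_{\gamma,\delta}$, and $0^{-1/2}=\infty$. **Theorem.** (1) For every Borel set $A^\star\subseteq[-\log n,\infty)^2$, $$d_{TV}\big(\mathrm{PRM}(\boldsymbol\lambda^\star),\mathrm{PRM}(\boldsymbol\lambda^\star_{\gamma,\delta})\big)\le\int_{A^\star}|\boldsymbol\lambda^\star(dz)-\boldsymbol\lambda^\star_{\gamma,\delta}(dz)|,$$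 $$d_2\big(\mathrm{PRM}(\boldsymbol\lambda^\star),\mathrm{PRM}(\boldsymbol\lambda^\star_{\gamma,\delta})\big)\le\Big(1\wedge1.65\min\{\boldsymbol\lambda^\star(A^\star)^{-1/2},\boldsymbol\lambda^\star_{\gamma,\delta}(A^\star)^{-1/2}\}\Big)\int_{A^\star}|\boldsymbol\lambda^\star(dz)-\boldsymbol\lambda^\star_{\gamma,\delta}(dz)|.$$ (2) Suppose in addition that $p_{10}=\gamma p_{11}$ and $p_{01}=\delta p_{11}$ (so $q_1=1-(1+\gamma)p_{11}$, $q_2=1-(1+\delta)p_{11}$, $p_{00}=1-(1+\gamma+\delta)p_{11}$), and let $A^\star=[u^\star,\infty)^2$ with $u^\star\ge-\log n$. Then the two right-hand sides in (1) are at most, respectively, $$\frac{4(1+\gamma+\delta)^2p_{11}}{[1-(1+\gamma+\delta)p_{11}]^3}\,e^{-u^\star}\qquad\text{and}\qquad\big(e^{-u^\star}\wedge1.65\,e^{-u^\star/2}\big)\frac{4(1+\gamma+\delta)^2p_{11}}{[1-(1+\gamma+\delta)p_{11}]^3},$$ and hence these also bound $d_{TV}\big(\mathrm{PRM}(\boldsymbol\lambda^\star),\mathrm{PRM}(\boldsymbol\lambda^\star_{\gamma,\delta})\big)$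 and $d_2\big(\mathrm{PRM}(\boldsymbol\lambda^\star),\mathrm{PRM}(\boldsymbol\lambda^\star_{\gamma,\delta})\big)$, respectively. -/

import Mathlib

open MeasureTheory ProbabilityTheory
open scoped ENNReal NNReal

noncomputable section

/-! ### Point measures, Poisson random measures and distances between their laws -/

/-- Finite point measures on `E`: finite sums of Dirac measures at not necessarily distinct points.
As a subtype of `Measure E` it carries the smallest σ-algebra that makes all evaluation maps
`ξ ↦ ξ B`, for `B` measurable, measurable. -/
abbrev PointMeasure (E : Type*) [MeasurableSpace E] : Type _ :=
  {ξ : Measure E // ∃ (m : ℕ) (z : Fin m → E), ξ = ∑ i, Measure.dirac (z i)}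

/-- `P` is the law of a Poisson process with mean measure `Λ`. -/
structure IsPRM {E : Type*} [MeasurableSpace E] (Λ : Measure E)
    (P : Measure (PointMeasure E)) : Prop where
  isProbabilityMeasure : IsProbabilityMeasure P
  count : ∀ B : Set E, MeasurableSet B → ∀ k : ℕ,
    P {ξ | ξ.1 B = k} = if Λ B = ⊤ then 0 else poissonMeasure (Λ B).toNNReal {k}
  indep : ∀ (m : ℕ) (B : Fin m → Set E), (∀ i, MeasurableSet (B i)) →
    Pairwise (fun i j => Disjoint (B i) (B j)) →
    iIndepFun (fun (i : Fin m) (ξ : PointMeasure E) => ξ.1 (B i)) P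

/-- Total variation distance between probability measures, `sup_B |μ(B) - ν(B)|`. -/
def dTV {X : Type*} [MeasurableSpace X] (μ ν : Measure X) : ℝ≥0∞ :=
  ⨆ (B : Set X) (_ : MeasurableSet B), ENNReal.ofReal |μ.real B - ν.real B|

/-- The distance `d₁` between finite measures that is induced by a metric `d₀ ≤ 1` on `E`:
it is `1` if the total masses differ, and otherwise the Wasserstein distance of the normalised
measures. The supremum over all Lipschitz functions `κ`, divided by the Lipschitz constant, is
written as the supremum over those `κ` with Lipschitz constant at most `1`.
Two zero measures have distance `0`. -/
def d1 {E : Type*} [MeasurableSpace E] (d₀ : E → E → ℝ) (ρ σ : Measure E) : ℝ :=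
  open Classical in
  if ρ Set.univ ≠ σ Set.univ then 1
  else (ρ.real Set.univ)⁻¹ *
    ⨆ κ : {κ : E → ℝ // ∀ x y, |κ x - κ y| ≤ d₀ x y}, |∫ x, κ.1 x ∂ρ - ∫ x, κ.1 x ∂σ|

/-- The distance `d₂` between probability measures on the space of finite point measures, i.e. the
Wasserstein distance induced by `d₁`. -/
def d2 {E : Type*} [MeasurableSpace E] (d₀ : E → E → ℝ)
    (μ ν : Measure (PointMeasure E)) : ℝ≥0∞ :=
  ⨆ (h : PointMeasure E → ℝ) (_ : Measurable h)
    (_ : ∀ ξ₁ ξ₂ : PointMeasure E, |h ξ₁ - h ξ₂| ≤ d1 d₀ ξ₁.1 ξ₂.1),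
    ENNReal.ofReal |∫ ξ, h ξ ∂μ - ∫ ξ, h ξ ∂ν|

/-- The variation measure `|μ - ν|` of the difference of two finite measures: the sum of the positive
part `μ - ν` and the negative part `ν - μ` of its Jordan decomposition (the subtraction of measures
is truncated at `0`). -/
def absDiff {E : Type*} [MeasurableSpace E] (μ ν : Measure E) : Measure E :=
  (μ - ν) + (ν - μ)

/-! ### The Marshall–Olkin geometric setting -/

/-- The joint distribution `pᵢⱼ = P(S = i, T = j)` of two Bernoulli random variables. -/
structure BernoulliPair where
  p00 : ℝ
  p01 : ℝ
  p10 : ℝ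
  p11 : ℝ
  p00_nonneg : 0 ≤ p00
  p01_nonneg : 0 ≤ p01
  p10_nonneg : 0 ≤ p10
  p11_nonneg : 0 ≤ p11
  sum_eq_one : p00 + p01 + p10 + p11 = 1

namespace BernoulliPair

/-- The failure probability `q₁ = P(S = 0)`. -/
def q1 (p : BernoulliPair) : ℝ := p.p00 + p.p01

/-- The failure probability `q₂ = P(T = 0)`. -/
def q2 (p : BernoulliPair) : ℝ := p.p00 + p.p10

/-- The intensity `λ*(s,t)` off the diagonal (with value `0` on the diagonal, a null set). -/
def intensity (p : BernoulliPair) (s t : ℝ) : ℝ :=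
  if s < t then
    Real.log (p.p00 / p.q2) * Real.log p.q2 / Real.log (1 / p.p00) ^ 2 *
      Real.exp (-(Real.log (p.p00 / p.q2) / Real.log p.p00) * s) *
      Real.exp (-(Real.log p.q2 / Real.log p.p00) * t)
  else if t < s then
    Real.log (p.p00 / p.q1) * Real.log p.q1 / Real.log (1 / p.p00) ^ 2 *
      Real.exp (-(Real.log p.q1 / Real.log p.p00) * s) *
      Real.exp (-(Real.log (p.p00 / p.q1) / Real.log p.p00) * t)
  else 0

/-- The intensity `λ́*(s)` on the diagonal. -/
def diagIntensity (p : BernoulliPair) (s : ℝ) : ℝ :=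
  Real.log (p.p00 / (p.q1 * p.q2)) / Real.log (1 / p.p00) * Real.exp (-s)

end BernoulliPair

/-- The intensity `λ*_{γ,δ}(s,t)` off the diagonal (with value `0` on the diagonal). -/
def limitIntensity (γ δ s t : ℝ) : ℝ :=
  if s < t then
    γ * (1 + δ) / (1 + γ + δ) ^ 2 *
      Real.exp (-(γ / (1 + γ + δ)) * s) * Real.exp (-((1 + δ) / (1 + γ + δ)) * t)
  else if t < s then
    δ * (1 + γ) / (1 + γ + δ) ^ 2 *
      Real.exp (-((1 + γ) / (1 + γ + δ)) * s) * Real.exp (-(δ / (1 + γ + δ)) * t)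
  else 0

/-- The intensity `λ́*_{γ,δ}(s)` on the diagonal. -/
def limitDiagIntensity (γ δ s : ℝ) : ℝ := 1 / (1 + γ + δ) * Real.exp (-s)

/-- The state space `[-log n, ∞)²`. -/
abbrev StateSpace (n : ℕ) : Type :=
  {z : ℝ × ℝ // -Real.log n ≤ z.1 ∧ -Real.log n ≤ z.2}

/-- The Euclidean distance on the state space, bounded by `1`. -/
def d0 {n : ℕ} (z w : StateSpace n) : ℝ :=
  min 1 (Real.sqrt ((z.1.1 - w.1.1) ^ 2 + (z.1.2 - w.1.2) ^ 2))

/-- The measure `B ↦ ∫∫_{A ∩ B} f(s,t) ds dt + ∫_{A ∩ B ∩ {s = t}} g(s) ds` on `[-log n, ∞)²`,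
where the diagonal is parametrised by `s ↦ (s, s)`. -/
def intensityMeasure {n : ℕ} (f : ℝ → ℝ → ℝ) (g : ℝ → ℝ) (A : Set (StateSpace n)) :
    Measure (StateSpace n) :=
  (Measure.comap (Subtype.val : StateSpace n → ℝ × ℝ)
    ((volume : Measure (ℝ × ℝ)).withDensity (fun z => ENNReal.ofReal (f z.1 z.2)) +
      Measure.map (fun s : ℝ => (s, s))
        ((volume : Measure ℝ).withDensity (fun s => ENNReal.ofReal (g s))))).restrict A

/-- The mean measure `λ*` on `A`. -/
def meanMeasure {n : ℕ} (p : BernoulliPair) (A : Set (StateSpace n)) : Measure (StateSpace n) :=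
  intensityMeasure p.intensity p.diagIntensity A

/-- The mean measure `λ*_{γ,δ}` on `A`. -/
def limitMeasure {n : ℕ} (γ δ : ℝ) (A : Set (StateSpace n)) : Measure (StateSpace n) :=
  intensityMeasure (limitIntensity γ δ) (limitDiagIntensity γ δ) A

/-- The set `[u, ∞)²` of joint exceedances of the threshold `u`. -/
def jointExceedance (n : ℕ) (u : ℝ) : Set (StateSpace n) := {z | u ≤ z.1.1 ∧ u ≤ z.1.2}

/-- The factor `1 ∧ 1.65 min(x^{-1/2}, y^{-1/2})`, where `0^{-1/2} = ∞`. -/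
def steinFactor (x y : ℝ≥0∞) : ℝ≥0∞ :=
  min 1 (ENNReal.ofReal 1.65 * min (x ^ (-(1 / 2) : ℝ)) (y ^ (-(1 / 2) : ℝ)))

end

/-!
The law of a Poisson process with finite mean measure `Λ` is determined by its characteristic
functional, hence it is the Poisson mixture of the laws of i.i.d. samples from the normalised `Λ`.
If `c ≤ Λ, Λ'` is the common part of the mean measures, the Poisson laws of `Λ` and `Λ'` both
dominate `exp (-|Λ - Λ'|)` times that of `c`, which bounds the total variation distance.

For `d₂`, let `M ≥ m` be the masses of `Λ` and `Λ'`. If `√M ≤ 1.65` the total variation bound is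
good enough. Otherwise, couple the normalised measures so that they differ with probability at most
`1 - c(E) / M`; this costs at most `0.65 |Λ - Λ'| / √M`. The Poisson numbers of points have
Hellinger affinity `exp (-(√M - √m)² / 2)`, so they cost at most
`√M - √m ≤ (M - m) / √M ≤ |Λ - Λ'| / √M`.

Both mean measures of the theorem belong to one family, indexed by two exponents `a, b ∈ (0, 1]`,
and have mass `exp (-u)` on `[u, ∞)²` whatever the exponents are, so the variation of their
difference is twice its positive part. For `x = (1 + γ + δ) p₁₁` the exponents are
`log (1 - α x) / log (1 - x)` for `λ*` and `α` for `λ*_{γ,δ}`, and the former lies between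
`(1 - x) α` and `α`.
-/

noncomputable section

variable {E : Type*} [MeasurableSpace E]

/-! ### The Poisson law as a mixture of product measures -/

namespace PointMeasure

/-- The point measure `∑ᵢ δ_{zᵢ}`. -/
def ofFun {k : ℕ} (z : Fin k → E) : PointMeasure E :=
  ⟨∑ i, Measure.dirac (z i), k, z, rfl⟩

theorem exists_eq_ofFun (ξ : PointMeasure E) : ∃ (k : ℕ) (z : Fin k → E), ξ = ofFun z := by
  obtain ⟨ξ, k, z, rfl⟩ := ξ
  exact ⟨k, z, rfl⟩

theorem ofFun_apply {k : ℕ} (z : Fin k → E) {B : Set E} (hB : MeasurableSet B) :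
    (ofFun z).1 B = ∑ i, B.indicator 1 (z i) := by
  simp [ofFun, Measure.dirac_apply' _ hB]

theorem ofFun_univ {k : ℕ} (z : Fin k → E) : (ofFun z).1 Set.univ = k := by
  simp [ofFun_apply z MeasurableSet.univ]

instance isFiniteMeasure (ξ : PointMeasure E) : IsFiniteMeasure ξ.1 := by
  obtain ⟨k, z, rfl⟩ := ξ.exists_eq_ofFun
  exact ⟨by rw [ofFun_univ]; exact ENNReal.natCast_lt_top k⟩

theorem exists_apply_eq_natCast (ξ : PointMeasure E) {B : Set E} (hB : MeasurableSet B) :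
    ∃ k : ℕ, ξ.1 B = k := by
  classical
  obtain ⟨m, z, rfl⟩ := ξ.exists_eq_ofFun
  exact ⟨(Finset.univ.filter fun i => z i ∈ B).card, by
    simp [ofFun_apply z hB, Set.indicator_apply]⟩

theorem measurable_apply {B : Set E} (hB : MeasurableSet B) :
    Measurable fun ξ : PointMeasure E => ξ.1 B :=
  (Measure.measurable_coe hB).comp measurable_subtype_coe

theorem measurable_real_apply {B : Set E} (hB : MeasurableSet B) :
    Measurable fun ξ : PointMeasure E => ξ.1.real B :=
  (measurable_apply hB).ennreal_toReal

theorem measurable_ofFun (k : ℕ) : Measurable (ofFun : (Fin k → E) → PointMeasure E) := by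
  refine Measurable.subtype_mk (Measure.measurable_of_measurable_coe _ fun B hB => ?_)
  change Measurable fun z : Fin k → E => (ofFun z).1 B
  simp_rw [ofFun_apply _ hB]
  exact Finset.measurable_fun_sum _ fun i _ =>
    (measurable_one.indicator hB).comp (measurable_pi_apply i)

theorem integral_ofFun {k : ℕ} (z : Fin k → E) {f : E → ℝ} (hf : Measurable f) :
    ∫ x, f x ∂(ofFun z).1 = ∑ i, f (z i) := by
  simp only [ofFun]
  rw [integral_finsetSum_measure]
  · exact Finset.sum_congr rfl fun i _ => integral_dirac' _ _ hf.stronglyMeasurable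
  · exact fun i _ => ⟨hf.aestronglyMeasurable, by
      simp [HasFiniteIntegral, lintegral_dirac' _ hf.enorm]⟩

end PointMeasure

/-- The law of the Poisson process with mean measure `Λ`, as a mixture over the number of points:
given that there are `k` points, these are independent with law `Λ / Λ(E)`. The factor `Λ(E)⁻ᵏ`
cancels against the Poisson weights, so that `Λ = 0` needs no special treatment. -/
def poissonLaw (Λ : Measure E) : Measure (PointMeasure E) :=
  Measure.sum fun k : ℕ => ENNReal.ofReal (Real.exp (-Λ.real Set.univ) / k.factorial) •
    (Measure.pi fun _ : Fin k => Λ).map PointMeasure.ofFun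

instance isProbabilityMeasure_poissonLaw (Λ : Measure E) [IsFiniteMeasure Λ] :
    IsProbabilityMeasure (poissonLaw Λ) := by
  refine ⟨?_⟩
  have h := hasSum_one_poissonMeasure (Λ Set.univ).toNNReal
  rw [poissonLaw, Measure.sum_apply _ MeasurableSet.univ, ← ENNReal.ofReal_one, ← h.tsum_eq,
    ENNReal.ofReal_tsum_of_nonneg (fun k => by positivity) h.summable]
  refine tsum_congr fun k => ?_
  rw [Measure.smul_apply, Measure.map_apply (PointMeasure.measurable_ofFun k) MeasurableSet.univ,
    Set.preimage_univ, Measure.pi_univ, mul_div_right_comm, ENNReal.ofReal_mul (by positivity),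
    ENNReal.ofReal_pow (by positivity)]
  simp [measureReal_def, ENNReal.coe_toNNReal_eq_toReal]

theorem hasSum_integral_poissonLaw (Λ : Measure E) {F : Type*} [NormedAddCommGroup F]
    [NormedSpace ℝ F] {h : PointMeasure E → F} (hh : Integrable h (poissonLaw Λ)) :
    HasSum (fun k : ℕ => (Real.exp (-Λ.real Set.univ) / k.factorial) •
      ∫ z, h (PointMeasure.ofFun z) ∂(Measure.pi fun _ : Fin k => Λ))
      (∫ ξ, h ξ ∂(poissonLaw Λ)) := by
  refine (hasSum_integral_measure hh).congr_fun fun k => ?_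
  have hc : ENNReal.ofReal (Real.exp (-Λ.real Set.univ) / k.factorial) ≠ 0 := by
    simp only [ne_eq, ENNReal.ofReal_eq_zero, not_le]
    positivity
  rw [integral_smul_measure, ENNReal.toReal_ofReal (by positivity),
    integral_map (PointMeasure.measurable_ofFun k).aemeasurable]
  refine (hh.aestronglyMeasurable.mono_measure (Measure.le_sum _ k)).mono_ac
    (Measure.AbsolutelyContinuous.mk fun s _ hs => ?_)
  simpa [hc] using hs

/-! ### Uniqueness of the law of a Poisson process -/

theorem simpleFunc_coe_finset_sum {ι : Type*} (s : Finset ι) (f : ι → SimpleFunc E ℝ) :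
    ⇑(∑ i ∈ s, f i) = ∑ i ∈ s, ⇑(f i) :=
  map_sum (⟨⟨(⇑), SimpleFunc.coe_zero⟩, SimpleFunc.coe_add⟩ : SimpleFunc E ℝ →+ E → ℝ) f s

theorem simpleFunc_integral_eq_sum (μ : Measure E) [IsFiniteMeasure μ] (f : SimpleFunc E ℝ) :
    ∫ x, f x ∂μ = ∑ y ∈ f.range, μ.real (f ⁻¹' {y}) * y := by
  rw [← SimpleFunc.integral_eq_integral f (SimpleFunc.integrable_of_isFiniteMeasure f),
    SimpleFunc.integral_eq]
  rfl

theorem hasSum_exp_neg_mul_pow (r : ℝ) (c : ℂ) :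
    HasSum (fun k : ℕ => (Real.exp (-r) / k.factorial) • c ^ k) (Complex.exp (c - r)) := by
  have h := (NormedSpace.expSeries_div_hasSum_exp c).mul_left (Real.exp (-r) : ℂ)
  rw [← Complex.exp_eq_exp_ℂ, Complex.ofReal_exp, ← Complex.exp_add, Complex.ofReal_neg,
    neg_add_eq_sub] at h
  refine h.congr_fun fun k => ?_
  rw [Complex.real_smul]
  push_cast
  ring

namespace PointMeasure

theorem measurable_integral_simpleFunc (f : SimpleFunc E ℝ) :
    Measurable fun ξ : PointMeasure E => ∫ x, f x ∂ξ.1 := by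
  simp_rw [simpleFunc_integral_eq_sum _ f]
  exact Finset.measurable_fun_sum _ fun y _ =>
    (measurable_real_apply (f.measurableSet_fiber y)).mul_const y

end PointMeasure

theorem integral_cexp_poissonLaw (Λ : Measure E) [IsFiniteMeasure Λ] (f : SimpleFunc E ℝ) :
    ∫ ξ, Complex.exp ((∫ x, f x ∂ξ.1 : ℝ) * Complex.I) ∂(poissonLaw Λ) =
      Complex.exp (∫ x, (Complex.exp (f x * Complex.I) - 1) ∂Λ) := by
  have hint : Integrable (fun ξ : PointMeasure E => Complex.exp ((∫ x, f x ∂ξ.1 : ℝ) * Complex.I))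
      (poissonLaw Λ) := by
    refine Integrable.of_bound (C := 1) ?_ (ae_of_all _ fun ξ => ?_)
    · have := PointMeasure.measurable_integral_simpleFunc f
      exact (by fun_prop : Measurable _).aestronglyMeasurable
    · rw [Complex.norm_exp_ofReal_mul_I]
  have hf : Integrable (fun x => Complex.exp (f x * Complex.I)) Λ := by
    refine Integrable.of_bound (C := 1) ?_ (ae_of_all _ fun ξ => ?_)
    · have := f.measurable
      exact (by fun_prop : Measurable _).aestronglyMeasurable
    · rw [Complex.norm_exp_ofReal_mul_I]
  refine (hasSum_integral_poissonLaw Λ hint).unique ?_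
  rw [integral_sub hf (integrable_const _), integral_const, Complex.real_smul, mul_one]
  refine (hasSum_exp_neg_mul_pow _ _).congr_fun fun k => ?_
  congr 1
  simp_rw [PointMeasure.integral_ofFun _ f.measurable, Complex.ofReal_sum, Finset.sum_mul,
    Complex.exp_sum]
  rw [integral_fintype_prod_eq_pow (fun x => Complex.exp (f x * Complex.I)), Fintype.card_fin]

theorem measurable_cexp_toReal_mul (y : ℝ) :
    Measurable fun x : ℝ≥0∞ => Complex.exp ((x.toReal * y : ℝ) * Complex.I) := by
  have := ENNReal.measurable_toReal
  fun_prop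

namespace IsPRM

variable {Λ : Measure E} [IsFiniteMeasure Λ] {P : Measure (PointMeasure E)}

theorem map_real_apply (hP : IsPRM Λ P) {B : Set E} (hB : MeasurableSet B) :
    P.map (fun ξ => ξ.1.real B) = (poissonMeasure (Λ B).toNNReal).map (Nat.cast : ℕ → ℝ) := by
  let N : PointMeasure E → ℕ := fun ξ => ⌊ξ.1.real B⌋₊
  have hN : Measurable N := Nat.measurable_floor.comp (PointMeasure.measurable_real_apply hB)
  have hNB (ξ : PointMeasure E) : ξ.1 B = N ξ := by
    obtain ⟨k, hk⟩ := ξ.exists_apply_eq_natCast hB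
    simp [N, measureReal_def, hk]
  have hlaw : P.map N = poissonMeasure (Λ B).toNNReal := by
    refine Measure.ext_of_singleton fun k => ?_
    rw [Measure.map_apply hN (measurableSet_singleton k)]
    simpa [hNB, Set.preimage] using hP.count B hB k
  rw [← hlaw, Measure.map_map (by fun_prop) hN]
  congr 1
  ext ξ
  simp [measureReal_def, hNB]

theorem integral_cexp_real_apply (hP : IsPRM Λ P) {B : Set E} (hB : MeasurableSet B) (y : ℝ) :
    ∫ ξ, Complex.exp ((ξ.1.real B * y : ℝ) * Complex.I) ∂P =
      Complex.exp (Λ.real B * (Complex.exp (y * Complex.I) - 1)) := by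
  have h := charFun_map_cast_poissonMeasure (Λ B).toNNReal y
  rw [← hP.map_real_apply hB, charFun_apply,
    integral_map (PointMeasure.measurable_real_apply hB).aemeasurable (by fun_prop)] at h
  simpa [mul_comm, measureReal_def, ENNReal.coe_toNNReal_eq_toReal] using h

theorem integral_cexp (hP : IsPRM Λ P) (f : SimpleFunc E ℝ) :
    ∫ ξ, Complex.exp ((∫ x, f x ∂ξ.1 : ℝ) * Complex.I) ∂P =
      Complex.exp (∫ x, (Complex.exp (f x * Complex.I) - 1) ∂Λ) := by
  have := hP.isProbabilityMeasure
  let e := f.range.equivFin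
  let B : Fin f.range.card → Set E := fun i => f ⁻¹' {(e.symm i : ℝ)}
  have hB (i) : MeasurableSet (B i) := f.measurableSet_fiber _
  have hdisj : Pairwise fun i j => Disjoint (B i) (B j) := fun i j hij =>
    Disjoint.preimage _ (Set.disjoint_singleton.mpr fun h => hij (e.symm.injective (Subtype.ext h)))
  have hsum (g : ℝ → ℂ) : ∑ y ∈ f.range, g y = ∑ i, g (e.symm i) := by
    rw [e.symm.sum_comp (fun y : f.range => g y), Finset.sum_coe_sort]
  have hprod (ξ : PointMeasure E) : Complex.exp ((∫ x, f x ∂ξ.1 : ℝ) * Complex.I) =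
      ∏ i, Complex.exp ((ξ.1.real (B i) * (e.symm i : ℝ) : ℝ) * Complex.I) := by
    rw [simpleFunc_integral_eq_sum, ← Complex.exp_sum, ← Finset.sum_mul, Complex.ofReal_sum, hsum]
  have hindep := (hP.indep _ B hB hdisj).integral_fun_prod_comp (𝕜 := ℂ)
    (f := fun i x => Complex.exp ((x.toReal * (e.symm i : ℝ) : ℝ) * Complex.I))
    (fun i => (PointMeasure.measurable_apply (hB i)).aemeasurable)
    (fun i => (measurable_cexp_toReal_mul _).aestronglyMeasurable)
  let g : SimpleFunc E ℂ := f.map fun y : ℝ => Complex.exp (y * Complex.I) - 1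
  have hg : ∫ x, (Complex.exp (f x * Complex.I) - 1) ∂Λ =
      ∑ i, Λ.real (B i) * (Complex.exp ((e.symm i : ℝ) * Complex.I) - 1) := by
    change ∫ x, g x ∂Λ = _
    rw [← SimpleFunc.integral_eq_integral g (SimpleFunc.integrable_of_isFiniteMeasure g),
      SimpleFunc.map_integral f _ (SimpleFunc.integrable_of_isFiniteMeasure f) (by simp),
      hsum (fun y => Λ.real (f ⁻¹' {y}) • (Complex.exp (y * Complex.I) - 1))]
    simp only [B, Complex.real_smul]
  simp_rw [hprod]
  rw [hg, Complex.exp_sum]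
  exact hindep.trans (Finset.prod_congr rfl fun i _ => hP.integral_cexp_real_apply (hB i) _)

end IsPRM

namespace PointMeasure

/-- The masses of all measurable sets, as a stochastic process on the space of point measures. -/
def masses (ξ : PointMeasure E) (B : {B : Set E // MeasurableSet B}) : ℝ := ξ.1.real B

theorem measurable_masses : Measurable (masses : PointMeasure E → _ → ℝ) :=
  measurable_pi_lambda _ fun B => measurable_real_apply B.2

theorem measurableSpace_le_comap_masses :
    (inferInstance : MeasurableSpace (PointMeasure E)) ≤
      MeasurableSpace.comap masses inferInstance := by
  let mΦ : MeasurableSpace (PointMeasure E) := MeasurableSpace.comap masses inferInstance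
  have hval : Measurable[mΦ] (Subtype.val : PointMeasure E → Measure E) := by
    refine Measure.measurable_of_measurable_coe _ fun B hB => ?_
    have h : (fun ξ : PointMeasure E => ξ.1 B) = fun ξ => ENNReal.ofReal (masses ξ ⟨B, hB⟩) :=
      funext fun ξ => (ENNReal.ofReal_toReal (measure_ne_top _ _)).symm
    rw [h]
    exact ((measurable_pi_apply _).comp (comap_measurable masses)).ennreal_ofReal
  exact hval.comap_le

theorem exists_simpleFunc_integral_eq (I : Finset {B : Set E // MeasurableSet B})
    (L : (I → ℝ) →L[ℝ] ℝ) :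
    ∃ f : SimpleFunc E ℝ, ∀ ξ : PointMeasure E, ∫ x, f x ∂ξ.1 = L (I.restrict (masses ξ)) := by
  classical
  let f (i : I) : SimpleFunc E ℝ :=
    SimpleFunc.piecewise i.1.1 i.1.2 (SimpleFunc.const E (L (Pi.single i 1))) 0
  have hf (i : I) : ⇑(f i) = i.1.1.indicator fun _ => L (Pi.single i 1) := by
    ext x
    simp [f, SimpleFunc.coe_piecewise, Set.piecewise, Set.indicator_apply]
  have hL (v : I → ℝ) : L v = ∑ i, v i * L (Pi.single i 1) := by
    conv_lhs => rw [← Finset.univ_sum_single v, map_sum]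
    refine Finset.sum_congr rfl fun i _ => ?_
    rw [← smul_eq_mul, ← map_smul, ← Pi.single_smul, smul_eq_mul, mul_one]
  refine ⟨∑ i, f i, fun ξ => ?_⟩
  simp only [simpleFunc_coe_finset_sum, Finset.sum_apply, hf]
  rw [integral_finsetSum _ fun i _ => (integrable_const _).indicator i.1.2, hL]
  exact Finset.sum_congr rfl fun i _ => integral_indicator_const _ i.1.2

variable {P Q : Measure (PointMeasure E)} [IsProbabilityMeasure P] [IsProbabilityMeasure Q]

theorem map_masses_eq_of_integral_cexp_eq
    (h : ∀ f : SimpleFunc E ℝ, ∫ ξ, Complex.exp ((∫ x, f x ∂ξ.1 : ℝ) * Complex.I) ∂P =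
      ∫ ξ, Complex.exp ((∫ x, f x ∂ξ.1 : ℝ) * Complex.I) ∂Q) :
    P.map masses = Q.map masses := by
  have hΦ := (measurable_masses (E := E)).aemeasurable (μ := P)
  have hΦ' := (measurable_masses (E := E)).aemeasurable (μ := Q)
  have := Measure.isProbabilityMeasure_map hΦ
  have := Measure.isProbabilityMeasure_map hΦ'
  have hfin (I : Finset {B : Set E // MeasurableSet B}) :
      (P.map masses).map I.restrict = (Q.map masses).map I.restrict := by
    have hI : Measurable (I.restrict (π := fun _ => ℝ)) := Finset.measurable_restrict I
    refine Measure.ext_of_charFunDual (funext fun L => ?_)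
    obtain ⟨f, hf⟩ := exists_simpleFunc_integral_eq I L
    have hL (μ : Measure ({B : Set E // MeasurableSet B} → ℝ)) : AEStronglyMeasurable
        (fun v => Complex.exp (L (I.restrict v) * Complex.I)) μ :=
      (by fun_prop : Measurable _).aestronglyMeasurable
    simp only [charFunDual_apply]
    rw [integral_map hI.aemeasurable (by fun_prop), integral_map hΦ (hL _),
      integral_map hI.aemeasurable (by fun_prop), integral_map hΦ' (hL _)]
    simpa only [hf] using h f
  have (I : Finset {B : Set E // MeasurableSet B}) :
    IsFiniteMeasure ((P.map masses).map I.restrict) := inferInstance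
  exact IsProjectiveLimit.unique (P := fun I => (P.map masses).map I.restrict) (fun _ => rfl)
    fun I => (hfin I).symm

theorem measure_ext_of_integral_cexp
    (h : ∀ f : SimpleFunc E ℝ, ∫ ξ, Complex.exp ((∫ x, f x ∂ξ.1 : ℝ) * Complex.I) ∂P =
      ∫ ξ, Complex.exp ((∫ x, f x ∂ξ.1 : ℝ) * Complex.I) ∂Q) : P = Q := by
  refine Measure.ext fun s hs => ?_
  obtain ⟨t, ht, rfl⟩ := measurableSpace_le_comap_masses s hs
  rw [← Measure.map_apply measurable_masses ht, map_masses_eq_of_integral_cexp_eq h,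
    Measure.map_apply measurable_masses ht]

end PointMeasure

theorem IsPRM.eq_poissonLaw {Λ : Measure E} [IsFiniteMeasure Λ] {P : Measure (PointMeasure E)}
    (hP : IsPRM Λ P) : P = poissonLaw Λ :=
  have := hP.isProbabilityMeasure
  PointMeasure.measure_ext_of_integral_cexp fun f => by
    rw [hP.integral_cexp f, integral_cexp_poissonLaw Λ f]

/-! ### Common parts and total variation -/

section CommonPart

theorem measure_add_sub_comm (μ ν : Measure E) [IsFiniteMeasure μ] [IsFiniteMeasure ν] :
    μ + (ν - μ) = ν + (μ - ν) := by
  have h := Measure.sub_toSignedMeasure_eq_toSignedMeasure_sub (μ := μ) (ν := ν)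
  rw [sub_eq_sub_iff_add_eq_add] at h
  refine Measure.ext fun s hs => ?_
  have hs' := congrArg (fun v : SignedMeasure E => v s) h
  simp only [_root_.add_apply, Measure.toSignedMeasure_apply_measurable hs] at hs'
  rw [← measureReal_eq_measureReal_iff, measureReal_add_apply, measureReal_add_apply, hs',
    add_comm]

theorem absDiff_comm (μ ν : Measure E) : absDiff μ ν = absDiff ν μ := add_comm _ _

instance isFiniteMeasure_absDiff (μ ν : Measure E) [IsFiniteMeasure μ] [IsFiniteMeasure ν] :
    IsFiniteMeasure (absDiff μ ν) := by
  unfold absDiff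
  infer_instance

theorem absDiff_apply_univ_of_apply_compl_eq_zero {μ ν : Measure E} {A : Set E}
    (hA : MeasurableSet A) (hμ : μ Aᶜ = 0) (hν : ν Aᶜ = 0) :
    absDiff μ ν Set.univ = absDiff μ ν A := by
  have hcompl : absDiff μ ν Aᶜ = 0 := by
    rw [absDiff, Measure.add_apply, add_eq_zero]
    exact ⟨le_zero_iff.mp ((Measure.sub_le _).trans_eq hμ),
      le_zero_iff.mp ((Measure.sub_le _).trans_eq hν)⟩
  rw [← measure_add_measure_compl hA, hcompl, add_zero]

theorem absDiff_apply_le_two_mul {μ ν τ : Measure E} [IsFiniteMeasure μ] [IsFiniteMeasure ν]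
    {A : Set E} (hA : μ A = ν A) (hle : ν ≤ μ + τ) : absDiff μ ν A ≤ 2 * τ A := by
  have hadd : μ A + (ν - μ) A = ν A + (μ - ν) A := by
    rw [← Measure.add_apply, measure_add_sub_comm, Measure.add_apply]
  rw [hA, ENNReal.add_right_inj (measure_ne_top ν A)] at hadd
  have hsub : (ν - μ) A ≤ τ A := Measure.sub_le_of_le_add (by rwa [add_comm]) A
  rw [absDiff, Measure.add_apply, ← hadd, ← two_mul]
  gcongr

theorem exists_le_le_absDiff_real_univ_eq (μ ν : Measure E) [IsFiniteMeasure μ]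
    [IsFiniteMeasure ν] : ∃ c : Measure E, c ≤ μ ∧ c ≤ ν ∧ (absDiff μ ν).real Set.univ =
      (μ.real Set.univ - c.real Set.univ) + (ν.real Set.univ - c.real Set.univ) := by
  have hcμ : μ - (μ - ν) + (μ - ν) = μ := Measure.sub_add_cancel_of_le Measure.sub_le
  have hcν : μ - (μ - ν) + (ν - μ) = ν := by
    refine Measure.ext fun s _ => (ENNReal.add_left_inj (measure_ne_top (μ - ν) s)).mp ?_
    rw [← Measure.add_apply, ← Measure.add_apply, add_right_comm, hcμ, measure_add_sub_comm]
  have hμ : (μ - (μ - ν)).real Set.univ + (μ - ν).real Set.univ = μ.real Set.univ := by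
    rw [← measureReal_add_apply, hcμ]
  have hν : (μ - (μ - ν)).real Set.univ + (ν - μ).real Set.univ = ν.real Set.univ := by
    rw [← measureReal_add_apply, hcν]
  refine ⟨μ - (μ - ν), Measure.sub_le, ?_, ?_⟩
  · exact (Measure.le_add_right le_rfl).trans_eq hcν
  · rw [absDiff, measureReal_add_apply]
    linarith

theorem exists_abs_sub_le_half {X : Type*} {h : X → ℝ} (hh : ∀ x y, |h x - h y| ≤ 1) :
    ∃ a, ∀ x, |h x - a| ≤ 1 / 2 := by
  have hbdd (x : X) : h x - 1 ∈ lowerBounds (Set.range h) := by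
    rintro _ ⟨y, rfl⟩
    linarith [(abs_le.mp (hh x y)).2]
  refine ⟨sInf (Set.range h) + 1 / 2, fun x => abs_le.mpr ?_⟩
  have hle : sInf (Set.range h) ≤ h x := csInf_le ⟨_, hbdd x⟩ ⟨x, rfl⟩
  have hge : h x - 1 ≤ sInf (Set.range h) := le_csInf ⟨h x, x, rfl⟩ (hbdd x)
  constructor <;> linarith

variable {X : Type*} [MeasurableSpace X] {P Q : Measure X} [IsProbabilityMeasure P]
  [IsProbabilityMeasure Q] {h : X → ℝ}

theorem abs_integral_sub_integral_le_of_le_of_le {ρ : Measure X} (hP : ρ ≤ P) (hQ : ρ ≤ Q)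
    (hh : Measurable h) {C : ℝ} (hC : ∀ x, |h x| ≤ C) :
    |∫ x, h x ∂P - ∫ x, h x ∂Q| ≤ 2 * C * (1 - ρ.real Set.univ) := by
  have := isFiniteMeasure_of_le P hP
  have hint (μ : Measure X) [IsFiniteMeasure μ] : Integrable h μ :=
    Integrable.of_bound hh.aestronglyMeasurable C (ae_of_all _ hC)
  have key (μ : Measure X) [IsProbabilityMeasure μ] (hμ : ρ ≤ μ) :
      ‖∫ x, h x ∂μ - ∫ x, h x ∂ρ‖ ≤ C * (1 - ρ.real Set.univ) := by
    have hadd := Measure.sub_add_cancel_of_le hμ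
    have hmass : (μ - ρ).real Set.univ = 1 - ρ.real Set.univ := by
      rw [← probReal_univ (μ := μ), ← hadd, measureReal_add_apply, hadd]
      ring
    have hsplit : ∫ x, h x ∂μ - ∫ x, h x ∂ρ = ∫ x, h x ∂(μ - ρ) := by
      rw [sub_eq_iff_eq_add, ← integral_add_measure (hint _) (hint _), hadd]
    rw [hsplit, ← hmass]
    exact norm_integral_le_of_norm_le_const (ae_of_all _ hC)
  calc |∫ x, h x ∂P - ∫ x, h x ∂Q|
      = ‖(∫ x, h x ∂P - ∫ x, h x ∂ρ) - (∫ x, h x ∂Q - ∫ x, h x ∂ρ)‖ := by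
        rw [sub_sub_sub_cancel_right, Real.norm_eq_abs]
    _ ≤ C * (1 - ρ.real Set.univ) + C * (1 - ρ.real Set.univ) :=
        norm_sub_le_of_le (key P hP) (key Q hQ)
    _ = 2 * C * (1 - ρ.real Set.univ) := by ring

theorem integral_sub_const_sub_integral_sub_const (hP : Integrable h P) (hQ : Integrable h Q)
    (a : ℝ) : ∫ x, (h x - a) ∂P - ∫ x, (h x - a) ∂Q = ∫ x, h x ∂P - ∫ x, h x ∂Q := by
  simp [integral_sub hP (integrable_const a), integral_sub hQ (integrable_const a)]

theorem dTV_le_of_forall_abs_le_half {b : ℝ≥0∞}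
    (hb : ∀ h : X → ℝ, Measurable h → (∀ x, |h x| ≤ 1 / 2) →
      ENNReal.ofReal |∫ x, h x ∂P - ∫ x, h x ∂Q| ≤ b) : dTV P Q ≤ b := by
  refine iSup₂_le fun B hB => ?_
  have hind (μ : Measure X) [IsProbabilityMeasure μ] : Integrable (B.indicator (1 : X → ℝ)) μ :=
    (integrable_const (1 : ℝ)).indicator hB
  have h := hb (fun x => B.indicator (1 : X → ℝ) x - 1 / 2)
    ((measurable_one.indicator hB).sub_const _) fun x => by
      by_cases hx : x ∈ B <;> norm_num [hx, abs_of_pos]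
  rwa [integral_sub_const_sub_integral_sub_const (hind P) (hind Q), integral_indicator_one hB,
    integral_indicator_one hB] at h

end CommonPart

theorem measure_pi_mono {ι : Type*} [Fintype ι] {X : ι → Type*} [∀ i, MeasurableSpace (X i)]
    {μ ν : ∀ i, Measure (X i)} (h : ∀ i, μ i ≤ ν i) : Measure.pi μ ≤ Measure.pi ν := by
  have hle : OuterMeasure.pi (fun i => (μ i).toOuterMeasure) ≤
      OuterMeasure.pi fun i => (ν i).toOuterMeasure :=
    OuterMeasure.le_pi.mpr fun s _ =>
      (OuterMeasure.pi_pi_le _ s).trans (Finset.prod_le_prod' fun i _ => h i (s i))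
  refine Measure.le_iff.mpr fun s hs => ?_
  rw [Measure.pi, Measure.pi, toMeasure_apply _ _ hs, toMeasure_apply _ _ hs]
  exact hle s

theorem exp_smul_poissonLaw_le {c Λ : Measure E} (h : c ≤ Λ) :
    ENNReal.ofReal (Real.exp (-(Λ.real Set.univ - c.real Set.univ))) • poissonLaw c ≤
      poissonLaw Λ := by
  refine Measure.le_iff.mpr fun s hs => ?_
  rw [Measure.smul_apply, poissonLaw, poissonLaw, Measure.sum_apply _ hs, Measure.sum_apply _ hs,
    smul_eq_mul, ← ENNReal.tsum_mul_left]
  refine ENNReal.tsum_le_tsum fun k => ?_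
  have hexp : Real.exp (-(Λ.real Set.univ - c.real Set.univ)) *
      (Real.exp (-c.real Set.univ) / k.factorial) = Real.exp (-Λ.real Set.univ) / k.factorial := by
    rw [mul_div_assoc', ← Real.exp_add]
    ring_nf
  simp only [Measure.smul_apply, smul_eq_mul]
  rw [← mul_assoc, ← ENNReal.ofReal_mul (Real.exp_nonneg _), hexp,
    Measure.map_apply (PointMeasure.measurable_ofFun k) hs,
    Measure.map_apply (PointMeasure.measurable_ofFun k) hs]
  gcongr
  exact measure_pi_mono fun _ => h

theorem abs_integral_poissonLaw_sub_le (Λ Λ' : Measure E) [IsFiniteMeasure Λ]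
    [IsFiniteMeasure Λ'] {h : PointMeasure E → ℝ} (hh : Measurable h)
    (hhalf : ∀ ξ, |h ξ| ≤ 1 / 2) :
    |∫ ξ, h ξ ∂(poissonLaw Λ) - ∫ ξ, h ξ ∂(poissonLaw Λ')| ≤ (absDiff Λ Λ').real Set.univ := by
  obtain ⟨c, hc, hc', hV⟩ := exists_le_le_absDiff_real_univ_eq Λ Λ'
  have := isFiniteMeasure_of_le Λ hc
  set V := (absDiff Λ Λ').real Set.univ
  have hmass : c.real Set.univ ≤ Λ.real Set.univ := ENNReal.toReal_mono (measure_ne_top _ _) (hc _)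
  have hmass' : c.real Set.univ ≤ Λ'.real Set.univ :=
    ENNReal.toReal_mono (measure_ne_top _ _) (hc' _)
  have hle (d : ℝ) (hd : d ≤ V) : ENNReal.ofReal (Real.exp (-V)) • poissonLaw c ≤
      ENNReal.ofReal (Real.exp (-d)) • poissonLaw c :=
    Measure.le_iff.mpr fun s _ => by
      simp only [Measure.smul_apply, smul_eq_mul]
      gcongr
  have hbound := abs_integral_sub_integral_le_of_le_of_le
    ((hle _ (by linarith)).trans (exp_smul_poissonLaw_le hc))
    ((hle _ (by linarith)).trans (exp_smul_poissonLaw_le hc')) hh hhalf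
  rw [measureReal_ennreal_smul_apply, probReal_univ, mul_one,
    ENNReal.toReal_ofReal (Real.exp_nonneg _)] at hbound
  linarith [Real.add_one_le_exp (-V)]

theorem ofReal_abs_integral_poissonLaw_sub_le (Λ Λ' : Measure E) [IsFiniteMeasure Λ]
    [IsFiniteMeasure Λ'] {h : PointMeasure E → ℝ} (hh : Measurable h)
    (hhalf : ∀ ξ, |h ξ| ≤ 1 / 2) :
    ENNReal.ofReal |∫ ξ, h ξ ∂(poissonLaw Λ) - ∫ ξ, h ξ ∂(poissonLaw Λ')| ≤
      absDiff Λ Λ' Set.univ :=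
  ENNReal.ofReal_le_of_le_toReal (abs_integral_poissonLaw_sub_le Λ Λ' hh hhalf)

theorem dTV_poissonLaw_le (Λ Λ' : Measure E) [IsFiniteMeasure Λ] [IsFiniteMeasure Λ'] :
    dTV (poissonLaw Λ) (poissonLaw Λ') ≤ absDiff Λ Λ' Set.univ :=
  dTV_le_of_forall_abs_le_half fun _ hh hhalf =>
    ofReal_abs_integral_poissonLaw_sub_le Λ Λ' hh hhalf

/-! ### Total variation of Poisson distributions -/

theorem tsum_abs_sub_le_of_hasSum_sqrt_mul {ι : Type*} {p q : ι → ℝ} {ρ : ℝ}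
    (hp : ∀ i, 0 ≤ p i) (hq : ∀ i, 0 ≤ q i) (hp1 : HasSum p 1) (hq1 : HasSum q 1)
    (hρ : HasSum (fun i => √(p i * q i)) ρ) :
    ∑' i, |p i - q i| ≤ 2 * √(1 - ρ ^ 2) := by
  have hpq (i) : (√(p i)) ^ 2 = p i ∧ (√(q i)) ^ 2 = q i ∧ √(p i * q i) = √(p i) * √(q i) :=
    ⟨Real.sq_sqrt (hp i), Real.sq_sqrt (hq i), Real.sqrt_mul (hp i) _⟩
  have hminus : HasSum (fun i => |√(p i) - √(q i)| ^ (2 : ℝ)) (1 + 1 - 2 * ρ) := by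
    refine ((hp1.add hq1).sub (hρ.mul_left 2)).congr_fun fun i => ?_
    obtain ⟨h1, h2, h3⟩ := hpq i
    rw [Real.rpow_two, sq_abs, h3]
    linear_combination h1 + h2
  have hplus : HasSum (fun i => (√(p i) + √(q i)) ^ (2 : ℝ)) (1 + 1 + 2 * ρ) := by
    refine ((hp1.add hq1).add (hρ.mul_left 2)).congr_fun fun i => ?_
    obtain ⟨h1, h2, h3⟩ := hpq i
    rw [Real.rpow_two, h3]
    linear_combination h1 + h2
  have hfactor (i) : |p i - q i| = |√(p i) - √(q i)| * (√(p i) + √(q i)) := by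
    obtain ⟨h1, h2, -⟩ := hpq i
    rw [← abs_of_nonneg (by positivity : 0 ≤ √(p i) + √(q i)), ← abs_mul]
    congr 1
    linear_combination -h1 + h2
  have hcs := Real.inner_le_Lp_mul_Lq_tsum_of_nonneg Real.HolderConjugate.two_two
    (fun i => abs_nonneg (√(p i) - √(q i))) (fun i => by positivity) hminus.summable hplus.summable
  rw [← tsum_congr hfactor, hminus.tsum_eq, hplus.tsum_eq, ← Real.sqrt_eq_rpow,
    ← Real.sqrt_eq_rpow, ← Real.sqrt_mul (hminus.nonneg fun i => by positivity)] at hcs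
  calc ∑' i, |p i - q i| ≤ √((1 + 1 - 2 * ρ) * (1 + 1 + 2 * ρ)) := hcs
    _ = √(2 ^ 2 * (1 - ρ ^ 2)) := by ring_nf
    _ = 2 * √(1 - ρ ^ 2) := by rw [Real.sqrt_mul (by norm_num), Real.sqrt_sq (by norm_num)]

theorem hasSum_poissonMeasure_real_singleton (r : ℝ≥0) :
    HasSum (fun k : ℕ => (poissonMeasure r).real {k}) 1 := by
  simpa only [poissonMeasure_real_singleton] using hasSum_one_poissonMeasure r

theorem sqrt_poissonMeasure_real_singleton_mul (r s : ℝ≥0) (k : ℕ) :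
    √((poissonMeasure r).real {k} * (poissonMeasure s).real {k}) =
      Real.exp (-(√r - √s) ^ 2 / 2) * (poissonMeasure (NNReal.sqrt (r * s))).real {k} := by
  obtain ⟨a, rfl⟩ : ∃ a, r = a ^ 2 := ⟨NNReal.sqrt r, (NNReal.sq_sqrt r).symm⟩
  obtain ⟨b, rfl⟩ : ∃ b, s = b ^ 2 := ⟨NNReal.sqrt s, (NNReal.sq_sqrt s).symm⟩
  have hexp : Real.exp (-a ^ 2) * Real.exp (-b ^ 2) =
      (Real.exp (-(a - b : ℝ) ^ 2 / 2) * Real.exp (-(a * b))) ^ 2 := by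
    rw [← Real.exp_add, ← Real.exp_add, ← Real.exp_nat_mul]
    ring_nf
  rw [← mul_pow, NNReal.sqrt_sq, Real.sqrt_eq_iff_eq_sq (by positivity) (by positivity)]
  simp only [poissonMeasure_real_singleton, NNReal.coe_pow, NNReal.coe_mul, Real.sqrt_sq,
    NNReal.zero_le_coe]
  linear_combination ((a : ℝ) ^ 2) ^ k * ((b : ℝ) ^ 2) ^ k / (k.factorial : ℝ) ^ 2 * hexp

theorem tsum_abs_poissonMeasure_sub_le {r s : ℝ≥0} (hsr : s ≤ r) :
    ∑' k : ℕ, |(poissonMeasure r).real {k} - (poissonMeasure s).real {k}| ≤ 2 * (√r - √s) := by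
  have hle : √(s : ℝ) ≤ √(r : ℝ) := Real.sqrt_le_sqrt hsr
  have haff : HasSum (fun k : ℕ => √((poissonMeasure r).real {k} * (poissonMeasure s).real {k}))
      (Real.exp (-(√r - √s) ^ 2 / 2)) := by
    simp_rw [sqrt_poissonMeasure_real_singleton_mul]
    simpa using (hasSum_poissonMeasure_real_singleton _).mul_left (Real.exp (-(√r - √s) ^ 2 / 2))
  refine (tsum_abs_sub_le_of_hasSum_sqrt_mul (fun _ => measureReal_nonneg)
    (fun _ => measureReal_nonneg) (hasSum_poissonMeasure_real_singleton r)
    (hasSum_poissonMeasure_real_singleton s) haff).trans ?_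
  gcongr
  refine Real.sqrt_le_iff.mpr ⟨sub_nonneg.mpr hle, ?_⟩
  have hexp : Real.exp (-(√r - √s) ^ 2 / 2) ^ 2 = Real.exp (-(√r - √s) ^ 2) := by
    rw [← Real.exp_nat_mul]
    ring_nf
  rw [hexp]
  linarith [Real.add_one_le_exp (-(√r - √s : ℝ) ^ 2)]

theorem abs_sub_le_of_hasSum_poissonMeasure_mul {r s : ℝ≥0} (hsr : s ≤ r) {a b : ℕ → ℝ} {A B D : ℝ}
    (hab : ∀ k, |a k - b k| ≤ D) (hb : ∀ k, |b k| ≤ 1 / 2)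
    (hA : HasSum (fun k => (poissonMeasure r).real {k} * a k) A)
    (hB : HasSum (fun k => (poissonMeasure s).real {k} * b k) B) :
    |A - B| ≤ D + (√r - √s) := by
  let p (t : ℝ≥0) (k : ℕ) : ℝ := (poissonMeasure t).real {k}
  have hp (t k) : 0 ≤ p t k := measureReal_nonneg
  have hp1 (t) : HasSum (p t) 1 := hasSum_poissonMeasure_real_singleton t
  have hmaj := ((hp1 r).mul_right D).add
    (((hp1 r).summable.sub (hp1 s).summable).abs.hasSum.mul_right (1 / 2))
  have hle (k) : |p r k * a k - p s k * b k| ≤ p r k * D + |p r k - p s k| * (1 / 2) :=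
    calc |p r k * a k - p s k * b k| = |p r k * (a k - b k) + (p r k - p s k) * b k| := by ring_nf
      _ ≤ p r k * |a k - b k| + |p r k - p s k| * |b k| := by
        refine (abs_add_le _ _).trans_eq ?_
        rw [abs_mul, abs_mul, abs_of_nonneg (hp r k)]
      _ ≤ p r k * D + |p r k - p s k| * (1 / 2) :=
        add_le_add (mul_le_mul_of_nonneg_left (hab k) (hp r k))
          (mul_le_mul_of_nonneg_left (hb k) (abs_nonneg _))
  have hAB : |A - B| ≤ 1 * D + (∑' k, |p r k - p s k|) * (1 / 2) :=
    (hA.sub hB).norm_le_of_bounded hmaj hle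
  linarith [tsum_abs_poissonMeasure_sub_le hsr]

/-! ### Couplings -/

section Coupling

theorem inv_measure_univ_mul_measure_univ_smul (μ : Measure E) [IsFiniteMeasure μ] :
    ((μ Set.univ)⁻¹ * μ Set.univ) • μ = μ := by
  rcases eq_or_ne μ 0 with rfl | hμ
  · exact smul_zero _
  · rw [ENNReal.inv_mul_cancel (Measure.measure_univ_ne_zero.mpr hμ) (measure_ne_top _ _),
      one_smul]

theorem exists_map_fst_map_snd_eq {F : Type*} [MeasurableSpace F] (μ : Measure E) (ν : Measure F)
    [IsFiniteMeasure μ] [IsFiniteMeasure ν] (h : μ Set.univ = ν Set.univ) :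
    ∃ π : Measure (E × F), π.map Prod.fst = μ ∧ π.map Prod.snd = ν := by
  refine ⟨(μ Set.univ)⁻¹ • μ.prod ν, ?_, ?_⟩
  · rw [Measure.map_smul, Measure.map_fst_prod, smul_smul, ← h,
      inv_measure_univ_mul_measure_univ_smul]
  · rw [Measure.map_smul, Measure.map_snd_prod, smul_smul, h,
      inv_measure_univ_mul_measure_univ_smul]

theorem exists_coupling [MeasurableEq E] {μ ν c : Measure E} [IsFiniteMeasure μ]
    [IsFiniteMeasure ν] (hμ : c ≤ μ) (hν : c ≤ ν) (h : μ Set.univ = ν Set.univ) :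
    ∃ π : Measure (E × E), π.map Prod.fst = μ ∧ π.map Prod.snd = ν ∧
      π.real (Set.diagonal E)ᶜ ≤ μ.real Set.univ - c.real Set.univ := by
  have := isFiniteMeasure_of_le μ hμ
  have hμc := Measure.sub_add_cancel_of_le hμ
  have hνc := Measure.sub_add_cancel_of_le hν
  obtain ⟨π, hfst, hsnd⟩ := exists_map_fst_map_snd_eq (μ - c) (ν - c) <|
    (ENNReal.add_left_inj (measure_ne_top c Set.univ)).mp <| by
      rw [← Measure.add_apply, ← Measure.add_apply, hμc, hνc, h]
  have hmk : Measurable fun x : E => (x, x) := measurable_id.prodMk measurable_id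
  refine ⟨π + c.map fun x => (x, x), ?_, ?_, ?_⟩
  · rw [Measure.map_add _ _ measurable_fst, hfst, Measure.map_map measurable_fst hmk]
    simpa only [Function.comp_def, Measure.map_id'] using hμc
  · rw [Measure.map_add _ _ measurable_snd, hsnd, Measure.map_map measurable_snd hmk]
    simpa only [Function.comp_def, Measure.map_id'] using hνc
  · have hoff : (c.map fun x => (x, x)) (Set.diagonal E)ᶜ = 0 := by
      rw [Measure.map_apply hmk measurableSet_diagonal.compl]
      simp [Set.preimage]
    have hπ : π (Set.diagonal E)ᶜ ≤ (μ - c) Set.univ := by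
      rw [← hfst, Measure.map_apply measurable_fst MeasurableSet.univ]
      exact measure_mono (Set.subset_univ _)
    have hmass : (μ - c).real Set.univ + c.real Set.univ = μ.real Set.univ := by
      rw [← measureReal_add_apply, hμc]
    rw [← hmass, add_sub_cancel_right, measureReal_def, Measure.add_apply, hoff, add_zero]
    exact ENNReal.toReal_mono (measure_ne_top _ _) hπ

variable {k : ℕ} {g : (Fin k → E) → ℝ} {C : ℝ}

theorem abs_integral_pi_map_fst_sub_le [MeasurableEq E] (π : Measure (E × E))
    [IsProbabilityMeasure π] (hg : Measurable g) (hC : ∀ x, |g x| ≤ C)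
    (hgl : ∀ x y : Fin k → E,
      |g x - g y| ≤ (k : ℝ)⁻¹ * ∑ i, (Set.diagonal E)ᶜ.indicator 1 (x i, y i)) :
    |∫ x, g x ∂(Measure.pi fun _ : Fin k => π.map Prod.fst) -
      ∫ x, g x ∂(Measure.pi fun _ : Fin k => π.map Prod.snd)| ≤ π.real (Set.diagonal E)ᶜ := by
  let πk : Measure (Fin k → E × E) := Measure.pi fun _ => π
  have : IsProbabilityMeasure (π.map Prod.fst) :=
    Measure.isProbabilityMeasure_map measurable_fst.aemeasurable
  have : IsProbabilityMeasure (π.map Prod.snd) :=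
    Measure.isProbabilityMeasure_map measurable_snd.aemeasurable
  have hfst : Measurable fun (w : Fin k → E × E) i => (w i).1 := by fun_prop
  have hsnd : Measurable fun (w : Fin k → E × E) i => (w i).2 := by fun_prop
  have hint {φ : (Fin k → E × E) → Fin k → E} (hφ : Measurable φ) :
      Integrable (fun w => g (φ w)) πk :=
    Integrable.of_bound (hg.comp hφ).aestronglyMeasurable C (ae_of_all _ fun w => hC _)
  have hind : Measurable ((Set.diagonal E)ᶜ.indicator (1 : E × E → ℝ)) :=
    measurable_one.indicator measurableSet_diagonal.compl
  have hindint (i) : Integrable (fun w => (Set.diagonal E)ᶜ.indicator (1 : E × E → ℝ) (w i)) πk :=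
    integrable_comp_eval (μ := fun _ : Fin k => π)
      ((integrable_const (1 : ℝ)).indicator measurableSet_diagonal.compl : Integrable _ π)
  have hindval (i) : ∫ w, (Set.diagonal E)ᶜ.indicator (1 : E × E → ℝ) (w i) ∂πk =
      π.real (Set.diagonal E)ᶜ := by
    rw [integral_comp_eval (μ := fun _ : Fin k => π) hind.aestronglyMeasurable,
      integral_indicator_one measurableSet_diagonal.compl]
  rw [← Measure.pi_map_pi fun _ => measurable_fst.aemeasurable,
    ← Measure.pi_map_pi fun _ => measurable_snd.aemeasurable,
    integral_map hfst.aemeasurable hg.aestronglyMeasurable,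
    integral_map hsnd.aemeasurable hg.aestronglyMeasurable, ← integral_sub (hint hfst) (hint hsnd)]
  calc |∫ w, (g (fun i => (w i).1) - g (fun i => (w i).2)) ∂πk|
      ≤ ∫ w, |g (fun i => (w i).1) - g (fun i => (w i).2)| ∂πk := abs_integral_le_integral_abs
    _ ≤ ∫ w, (k : ℝ)⁻¹ * ∑ i, (Set.diagonal E)ᶜ.indicator 1 (w i) ∂πk :=
        integral_mono ((hint hfst).sub (hint hsnd)).abs
          ((integrable_finsetSum _ fun i _ => hindint i).const_mul _) fun w => hgl _ _
    _ = (k : ℝ)⁻¹ * k * π.real (Set.diagonal E)ᶜ := by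
        rw [integral_const_mul, integral_finsetSum _ fun i _ => hindint i]
        simp [hindval, mul_assoc]
    _ ≤ π.real (Set.diagonal E)ᶜ := mul_le_of_le_one_left measureReal_nonneg inv_mul_le_one

theorem abs_integral_pi_sub_integral_pi_le [MeasurableEq E] {μ ν c : Measure E}
    [IsProbabilityMeasure μ] [IsProbabilityMeasure ν] (hμ : c ≤ μ) (hν : c ≤ ν)
    (hg : Measurable g) (hC : ∀ x, |g x| ≤ C)
    (hgl : ∀ x y : Fin k → E,
      |g x - g y| ≤ (k : ℝ)⁻¹ * ∑ i, (Set.diagonal E)ᶜ.indicator 1 (x i, y i)) :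
    |∫ x, g x ∂(Measure.pi fun _ : Fin k => μ) - ∫ x, g x ∂(Measure.pi fun _ : Fin k => ν)| ≤
      1 - c.real Set.univ := by
  obtain ⟨π, hfst, hsnd, hdiag⟩ := exists_coupling hμ hν (by simp only [measure_univ])
  have : IsProbabilityMeasure π := ⟨by
    rw [← measure_univ (μ := μ), ← hfst, Measure.map_apply measurable_fst MeasurableSet.univ,
      Set.preimage_univ]⟩
  rw [probReal_univ] at hdiag
  have h := abs_integral_pi_map_fst_sub_le π hg hC hgl
  rw [hfst, hsnd] at h
  exact h.trans hdiag

end Coupling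

/-! ### The distance `d₂` of Poisson laws -/

section D2

variable {d₀ : E → E → ℝ}

theorem d1_ofFun_le [MeasurableSingletonClass E] (hnn : ∀ x y, 0 ≤ d₀ x y) {k : ℕ}
    (x y : Fin k → E) :
    d1 d₀ (PointMeasure.ofFun x).1 (PointMeasure.ofFun y).1 ≤
      (k : ℝ)⁻¹ * ∑ i, d₀ (x i) (y i) := by
  have : Nonempty {κ : E → ℝ // ∀ x y, |κ x - κ y| ≤ d₀ x y} :=
    ⟨0, fun x y => by simpa using hnn x y⟩
  rw [d1, if_neg (by simp [PointMeasure.ofFun_univ]), measureReal_def, PointMeasure.ofFun_univ,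
    ENNReal.toReal_natCast]
  gcongr
  refine ciSup_le fun κ => ?_
  have hint (z : Fin k → E) : ∫ x, κ.1 x ∂(PointMeasure.ofFun z).1 = ∑ i, κ.1 (z i) := by
    simp only [PointMeasure.ofFun]
    rw [integral_finsetSum_measure fun i _ => integrable_dirac (by simp)]
    simp only [integral_dirac]
  rw [hint, hint, ← Finset.sum_sub_distrib]
  exact (Finset.abs_sum_le_sum_abs _ _).trans (Finset.sum_le_sum fun i _ => κ.2 _ _)

theorem d1_le_one [MeasurableSingletonClass E] (hd₀ : ∀ x y, d₀ x y ∈ Set.Icc 0 1)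
    (ξ₁ ξ₂ : PointMeasure E) : d1 d₀ ξ₁.1 ξ₂.1 ≤ 1 := by
  obtain ⟨k, x, rfl⟩ := ξ₁.exists_eq_ofFun
  obtain ⟨l, y, rfl⟩ := ξ₂.exists_eq_ofFun
  rcases eq_or_ne k l with rfl | hkl
  · calc d1 d₀ (PointMeasure.ofFun x).1 (PointMeasure.ofFun y).1
        ≤ (k : ℝ)⁻¹ * ∑ i, d₀ (x i) (y i) := d1_ofFun_le (fun x y => (hd₀ x y).1) x y
      _ ≤ (k : ℝ)⁻¹ * ∑ _i : Fin k, 1 := by gcongr; exact (hd₀ _ _).2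
      _ ≤ 1 := by simpa using inv_mul_le_one
  · rw [d1, if_pos (by simpa [PointMeasure.ofFun_univ] using hkl)]

theorem d2_le_of_forall_abs_le_half [MeasurableSingletonClass E]
    (hd₀ : ∀ x y, d₀ x y ∈ Set.Icc 0 1) {P Q : Measure (PointMeasure E)} [IsProbabilityMeasure P]
    [IsProbabilityMeasure Q] {b : ℝ≥0∞}
    (hb : ∀ h : PointMeasure E → ℝ, Measurable h → (∀ ξ, |h ξ| ≤ 1 / 2) →
      (∀ ξ₁ ξ₂ : PointMeasure E, |h ξ₁ - h ξ₂| ≤ d1 d₀ ξ₁.1 ξ₂.1) →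
      ENNReal.ofReal |∫ ξ, h ξ ∂P - ∫ ξ, h ξ ∂Q| ≤ b) : d2 d₀ P Q ≤ b := by
  refine iSup_le fun h => iSup₂_le fun hh hlip => ?_
  obtain ⟨a, ha⟩ := exists_abs_sub_le_half fun ξ₁ ξ₂ => (hlip ξ₁ ξ₂).trans (d1_le_one hd₀ ξ₁ ξ₂)
  have hint (R : Measure (PointMeasure E)) [IsProbabilityMeasure R] : Integrable h R :=
    Integrable.of_bound hh.aestronglyMeasurable (1 / 2 + |a|) <| ae_of_all _ fun ξ =>
      (norm_le_norm_sub_add _ a).trans (add_le_add_left (ha ξ) _)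
  rw [← integral_sub_const_sub_integral_sub_const (hint P) (hint Q) a]
  refine hb _ (hh.sub_const a) ha fun ξ₁ ξ₂ => ?_
  simpa only [sub_sub_sub_cancel_right] using hlip ξ₁ ξ₂

theorem measure_pi_const_smul {k : ℕ} (μ : Measure E) [IsFiniteMeasure μ] (r : ℝ≥0) :
    Measure.pi (fun _ : Fin k => r • μ) = r ^ k • Measure.pi fun _ : Fin k => μ := by
  refine Measure.pi_eq fun s _ => ?_
  simp only [Measure.smul_apply, Measure.pi_pi, ENNReal.smul_def, smul_eq_mul,
    Finset.prod_mul_distrib, Finset.prod_const, Finset.card_univ, Fintype.card_fin,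
    ENNReal.coe_pow]

theorem hasSum_integral_poissonLaw_smul (μ : Measure E) [IsProbabilityMeasure μ] (r : ℝ≥0)
    {h : PointMeasure E → ℝ} (hh : Integrable h (poissonLaw (r • μ))) :
    HasSum (fun k : ℕ => (poissonMeasure r).real {k} *
      ∫ z, h (PointMeasure.ofFun z) ∂(Measure.pi fun _ : Fin k => μ))
      (∫ ξ, h ξ ∂(poissonLaw (r • μ))) := by
  refine (hasSum_integral_poissonLaw _ hh).congr_fun fun k => ?_
  rw [measureReal_nnreal_smul_apply, probReal_univ, mul_one, measure_pi_const_smul,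
    integral_smul_nnreal_measure, poissonMeasure_real_singleton, smul_eq_mul, NNReal.smul_def,
    smul_eq_mul, NNReal.coe_pow]
  ring

theorem exists_eq_smul_isProbabilityMeasure [Nonempty E] (Λ : Measure E) [IsFiniteMeasure Λ] :
    ∃ μ : Measure E, IsProbabilityMeasure μ ∧ Λ = (Λ Set.univ).toNNReal • μ :=
  let Λ' : FiniteMeasure E := ⟨Λ, inferInstance⟩
  ⟨Λ'.normalize, inferInstance, congrArg Subtype.val Λ'.self_eq_mass_smul_normalize⟩

variable [MeasurableEq E] {h : PointMeasure E → ℝ}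

theorem abs_integral_poissonLaw_smul_sub_le (hd₀ : ∀ x y, d₀ x y ∈ Set.Icc 0 1)
    (hdiag : ∀ x, d₀ x x = 0) {μ ν c : Measure E} [IsProbabilityMeasure μ]
    [IsProbabilityMeasure ν] {r s : ℝ≥0} (hr : r ≠ 0) (hsr : s ≤ r) (hμ : c ≤ r • μ)
    (hν : c ≤ s • ν) (hh : Measurable h) (hhalf : ∀ ξ, |h ξ| ≤ 1 / 2)
    (hlip : ∀ ξ₁ ξ₂ : PointMeasure E, |h ξ₁ - h ξ₂| ≤ d1 d₀ ξ₁.1 ξ₂.1) :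
    |∫ ξ, h ξ ∂(poissonLaw (r • μ)) - ∫ ξ, h ξ ∂(poissonLaw (s • ν))| ≤
      (1 - c.real Set.univ / r) + (√r - √s) := by
  have hscale {ρ : Measure E} {t : ℝ≥0} (ht : t ≤ r) (hc : c ≤ t • ρ) : r⁻¹ • c ≤ ρ :=
    Measure.le_iff.mpr fun B _ => by
      calc (r⁻¹ • c) B ≤ r⁻¹ • (r • ρ B) := by
            refine smul_le_smul_of_nonneg_left ((hc B).trans ?_) zero_le
            exact smul_le_smul_of_nonneg_right ht zero_le
        _ = ρ B := inv_smul_smul₀ hr _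
  have hint (R : Measure (PointMeasure E)) [IsProbabilityMeasure R] : Integrable h R :=
    Integrable.of_bound hh.aestronglyMeasurable (1 / 2) (ae_of_all _ hhalf)
  have hchange (k : ℕ) (x y : Fin k → E) : |h (.ofFun x) - h (.ofFun y)| ≤
      (k : ℝ)⁻¹ * ∑ i, (Set.diagonal E)ᶜ.indicator 1 (x i, y i) := by
    refine (hlip _ _).trans ((d1_ofFun_le (fun x y => (hd₀ x y).1) x y).trans ?_)
    gcongr with i
    by_cases hxy : x i = y i
    · simp [hxy, hdiag]
    · simpa [hxy] using (hd₀ (x i) (y i)).2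
  have hcouple (k : ℕ) := abs_integral_pi_sub_integral_pi_le (hscale le_rfl hμ) (hscale hsr hν)
    (hh.comp (PointMeasure.measurable_ofFun k)) (fun z => hhalf _) (hchange k)
  rw [measureReal_nnreal_smul_apply, NNReal.coe_inv, inv_mul_eq_div] at hcouple
  refine abs_sub_le_of_hasSum_poissonMeasure_mul hsr hcouple (fun k => ?_)
    (hasSum_integral_poissonLaw_smul μ r (hint _)) (hasSum_integral_poissonLaw_smul ν s (hint _))
  simpa using norm_integral_le_of_norm_le_const (μ := Measure.pi fun _ : Fin k => ν)
    (f := fun z => h (.ofFun z)) (ae_of_all _ fun z => hhalf _)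

theorem abs_integral_poissonLaw_sub_le_of_le_of_le (hd₀ : ∀ x y, d₀ x y ∈ Set.Icc 0 1)
    (hdiag : ∀ x, d₀ x x = 0) {Λ Λ' c : Measure E} [IsFiniteMeasure Λ] [IsFiniteMeasure Λ']
    (hc : c ≤ Λ) (hc' : c ≤ Λ') (hpos : 0 < Λ.real Set.univ)
    (hmass : Λ'.real Set.univ ≤ Λ.real Set.univ) (hh : Measurable h) (hhalf : ∀ ξ, |h ξ| ≤ 1 / 2)
    (hlip : ∀ ξ₁ ξ₂ : PointMeasure E, |h ξ₁ - h ξ₂| ≤ d1 d₀ ξ₁.1 ξ₂.1) :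
    |∫ ξ, h ξ ∂(poissonLaw Λ) - ∫ ξ, h ξ ∂(poissonLaw Λ')| ≤
      (1 - c.real Set.univ / Λ.real Set.univ) + (√(Λ.real Set.univ) - √(Λ'.real Set.univ)) := by
  have : Nonempty E := not_isEmpty_iff.mp fun _ => by simp [Λ.eq_zero_of_isEmpty] at hpos
  obtain ⟨μ, hμ, hΛ⟩ := exists_eq_smul_isProbabilityMeasure Λ
  obtain ⟨ν, hν, hΛ'⟩ := exists_eq_smul_isProbabilityMeasure Λ'
  have h := abs_integral_poissonLaw_smul_sub_le hd₀ hdiag (NNReal.coe_ne_zero.mp hpos.ne')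
    (NNReal.coe_le_coe.mp hmass) (hc.trans_eq hΛ) (hc'.trans_eq hΛ') hh hhalf hlip
  rwa [← hΛ, ← hΛ'] at h

theorem sqrt_mul_abs_integral_poissonLaw_sub_le_of_le (hd₀ : ∀ x y, d₀ x y ∈ Set.Icc 0 1)
    (hdiag : ∀ x, d₀ x x = 0) {Λ Λ' : Measure E} [IsFiniteMeasure Λ] [IsFiniteMeasure Λ']
    (hmass : Λ'.real Set.univ ≤ Λ.real Set.univ) (hh : Measurable h) (hhalf : ∀ ξ, |h ξ| ≤ 1 / 2)
    (hlip : ∀ ξ₁ ξ₂ : PointMeasure E, |h ξ₁ - h ξ₂| ≤ d1 d₀ ξ₁.1 ξ₂.1) :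
    √(Λ.real Set.univ) * |∫ ξ, h ξ ∂(poissonLaw Λ) - ∫ ξ, h ξ ∂(poissonLaw Λ')| ≤
      1.65 * (absDiff Λ Λ').real Set.univ := by
  rcases le_total (√(Λ.real Set.univ)) 1.65 with hsmall | hbig
  · gcongr
    exact abs_integral_poissonLaw_sub_le Λ Λ' hh hhalf
  obtain ⟨c, hc, hc', hV⟩ := exists_le_le_absDiff_real_univ_eq Λ Λ'
  have hcm : c.real Set.univ ≤ Λ'.real Set.univ :=
    ENNReal.toReal_mono (measure_ne_top _ _) (hc' _)
  have hpos : 0 < Λ.real Set.univ := Real.sqrt_pos.mp (hbig.trans_lt' (by norm_num))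
  have hdiff :=
    abs_integral_poissonLaw_sub_le_of_le_of_le hd₀ hdiag hc hc' hpos hmass hh hhalf hlip
  have hsq := Real.sq_sqrt hpos.le
  have hsq' := Real.sq_sqrt (measureReal_nonneg (μ := Λ') (s := Set.univ))
  have hsqrt := Real.sqrt_le_sqrt hmass
  set M := Λ.real Set.univ
  set m := Λ'.real Set.univ
  set V := (absDiff Λ Λ').real Set.univ
  have : 0 < √M := by positivity
  have hshape : √M * (1 - c.real Set.univ / M) ≤ 0.65 * V := by
    have hinv : (√M)⁻¹ ≤ 0.65 := inv_le_of_inv_le₀ (by norm_num) (by norm_num; linarith)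
    calc √M * (1 - c.real Set.univ / M) = (√M)⁻¹ * (M - c.real Set.univ) := by
          field_simp
          rw [hsq]
      _ ≤ 0.65 * V := by gcongr <;> linarith
  have hcount : √M * (√M - √m) ≤ V := by nlinarith [Real.sqrt_nonneg m]
  calc √M * |∫ ξ, h ξ ∂(poissonLaw Λ) - ∫ ξ, h ξ ∂(poissonLaw Λ')|
      ≤ √M * ((1 - c.real Set.univ / M) + (√M - √m)) := by gcongr
    _ ≤ 1.65 * V := by linarith

theorem sqrt_mul_abs_integral_poissonLaw_sub_le (hd₀ : ∀ x y, d₀ x y ∈ Set.Icc 0 1)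
    (hdiag : ∀ x, d₀ x x = 0) (Λ Λ' : Measure E) [IsFiniteMeasure Λ] [IsFiniteMeasure Λ']
    (hh : Measurable h) (hhalf : ∀ ξ, |h ξ| ≤ 1 / 2)
    (hlip : ∀ ξ₁ ξ₂ : PointMeasure E, |h ξ₁ - h ξ₂| ≤ d1 d₀ ξ₁.1 ξ₂.1) :
    √(Λ.real Set.univ) * |∫ ξ, h ξ ∂(poissonLaw Λ) - ∫ ξ, h ξ ∂(poissonLaw Λ')| ≤
      1.65 * (absDiff Λ Λ').real Set.univ := by
  rcases le_total (Λ'.real Set.univ) (Λ.real Set.univ) with hmass | hmass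
  · exact sqrt_mul_abs_integral_poissonLaw_sub_le_of_le hd₀ hdiag hmass hh hhalf hlip
  · have hswap := sqrt_mul_abs_integral_poissonLaw_sub_le_of_le hd₀ hdiag hmass hh hhalf hlip
    rw [abs_sub_comm, absDiff_comm] at hswap
    refine hswap.trans' ?_
    gcongr

theorem rpow_half_mul_ofReal_abs_integral_poissonLaw_sub_le (hd₀ : ∀ x y, d₀ x y ∈ Set.Icc 0 1)
    (hdiag : ∀ x, d₀ x x = 0) (Λ Λ' : Measure E) [IsFiniteMeasure Λ] [IsFiniteMeasure Λ']
    (hh : Measurable h) (hhalf : ∀ ξ, |h ξ| ≤ 1 / 2)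
    (hlip : ∀ ξ₁ ξ₂ : PointMeasure E, |h ξ₁ - h ξ₂| ≤ d1 d₀ ξ₁.1 ξ₂.1) :
    Λ Set.univ ^ (1 / 2 : ℝ) *
        ENNReal.ofReal |∫ ξ, h ξ ∂(poissonLaw Λ) - ∫ ξ, h ξ ∂(poissonLaw Λ')| ≤
      ENNReal.ofReal 1.65 * absDiff Λ Λ' Set.univ := by
  have hbound := ENNReal.ofReal_le_ofReal
    (sqrt_mul_abs_integral_poissonLaw_sub_le hd₀ hdiag Λ Λ' hh hhalf hlip)
  rwa [ENNReal.ofReal_mul (Real.sqrt_nonneg _), ENNReal.ofReal_mul (by norm_num),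
    Real.sqrt_eq_rpow, ← ENNReal.ofReal_rpow_of_nonneg measureReal_nonneg (by norm_num),
    ofReal_measureReal, ofReal_measureReal] at hbound

theorem le_steinFactor_mul {D V x y : ℝ≥0∞} (hV : V ≠ ⊤) (hD : D ≤ V)
    (hx : x ^ (1 / 2 : ℝ) * D ≤ ENNReal.ofReal 1.65 * V)
    (hy : y ^ (1 / 2 : ℝ) * D ≤ ENNReal.ofReal 1.65 * V) : D ≤ steinFactor x y * V := by
  have key {z : ℝ≥0∞} (hz : z ^ (1 / 2 : ℝ) * D ≤ ENNReal.ofReal 1.65 * V) :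
      D ≤ ENNReal.ofReal 1.65 * z ^ (-(1 / 2) : ℝ) * V := by
    rcases eq_or_ne V 0 with rfl | hV0
    · simpa using hD
    have hV1 : ENNReal.ofReal 1.65 * V ≠ 0 := mul_ne_zero (by norm_num) hV0
    rwa [ENNReal.rpow_neg, mul_right_comm, ← div_eq_mul_inv,
      ENNReal.le_div_iff_mul_le (.inr hV1) (.inr (ENNReal.mul_ne_top ENNReal.ofReal_ne_top hV)),
      mul_comm]
  rw [steinFactor]
  rcases min_choice 1 (ENNReal.ofReal 1.65 * min (x ^ (-(1 / 2) : ℝ)) (y ^ (-(1 / 2) : ℝ)))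
    with h | h
  · rwa [h, one_mul]
  · rw [h]
    rcases min_choice (x ^ (-(1 / 2) : ℝ)) (y ^ (-(1 / 2) : ℝ)) with h | h <;> rw [h]
    exacts [key hx, key hy]

theorem d2_poissonLaw_le (hd₀ : ∀ x y, d₀ x y ∈ Set.Icc 0 1) (hdiag : ∀ x, d₀ x x = 0)
    (Λ Λ' : Measure E) [IsFiniteMeasure Λ] [IsFiniteMeasure Λ'] :
    d2 d₀ (poissonLaw Λ) (poissonLaw Λ') ≤
      steinFactor (Λ Set.univ) (Λ' Set.univ) * absDiff Λ Λ' Set.univ := by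
  refine d2_le_of_forall_abs_le_half hd₀ fun h hh hhalf hlip => ?_
  refine le_steinFactor_mul (measure_ne_top _ _)
    (ofReal_abs_integral_poissonLaw_sub_le Λ Λ' hh hhalf)
    (rpow_half_mul_ofReal_abs_integral_poissonLaw_sub_le hd₀ hdiag Λ Λ' hh hhalf hlip) ?_
  rw [abs_sub_comm, absDiff_comm]
  exact rpow_half_mul_ofReal_abs_integral_poissonLaw_sub_le hd₀ hdiag Λ' Λ hh hhalf hlip

end D2

namespace IsPRM

variable {Λ Λ' : Measure E} [IsFiniteMeasure Λ] [IsFiniteMeasure Λ']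
  {P P' : Measure (PointMeasure E)}

theorem dTV_le (hP : IsPRM Λ P) (hP' : IsPRM Λ' P') : dTV P P' ≤ absDiff Λ Λ' Set.univ := by
  rw [hP.eq_poissonLaw, hP'.eq_poissonLaw]
  exact dTV_poissonLaw_le Λ Λ'

theorem d2_le [MeasurableEq E] {d₀ : E → E → ℝ} (hd₀ : ∀ x y, d₀ x y ∈ Set.Icc 0 1)
    (hdiag : ∀ x, d₀ x x = 0) (hP : IsPRM Λ P) (hP' : IsPRM Λ' P') :
    d2 d₀ P P' ≤ steinFactor (Λ Set.univ) (Λ' Set.univ) * absDiff Λ Λ' Set.univ := by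
  rw [hP.eq_poissonLaw, hP'.eq_poissonLaw]
  exact d2_poissonLaw_le hd₀ hdiag Λ Λ'

variable {A : Set E}

theorem dTV_le_of_apply_compl_eq_zero (hA : MeasurableSet A) (hΛ : Λ Aᶜ = 0) (hΛ' : Λ' Aᶜ = 0)
    (hP : IsPRM Λ P) (hP' : IsPRM Λ' P') : dTV P P' ≤ absDiff Λ Λ' A :=
  (hP.dTV_le hP').trans_eq (absDiff_apply_univ_of_apply_compl_eq_zero hA hΛ hΛ')

theorem d2_le_of_apply_compl_eq_zero [MeasurableEq E] {d₀ : E → E → ℝ}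
    (hd₀ : ∀ x y, d₀ x y ∈ Set.Icc 0 1) (hdiag : ∀ x, d₀ x x = 0) (hA : MeasurableSet A)
    (hΛ : Λ Aᶜ = 0) (hΛ' : Λ' Aᶜ = 0) (hP : IsPRM Λ P) (hP' : IsPRM Λ' P') :
    d2 d₀ P P' ≤ steinFactor (Λ A) (Λ' A) * absDiff Λ Λ' A := by
  rw [measure_of_measure_compl_eq_zero hΛ, measure_of_measure_compl_eq_zero hΛ',
    ← absDiff_apply_univ_of_apply_compl_eq_zero hA hΛ hΛ']
  exact hP.d2_le hd₀ hdiag hP'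

end IsPRM

/-! ### Marshall–Olkin intensities -/

section MarshallOlkin

/-- The intensity `b (1 - b) exp (-(1 - b) s - b t)` on the wedge `s < t`, one half of the
off-diagonal intensity of a Marshall–Olkin process. -/
def wedgeIntensity (b s t : ℝ) : ℝ :=
  if s < t then b * (1 - b) * Real.exp (-(1 - b) * s) * Real.exp (-b * t) else 0

/-- The off-diagonal Marshall–Olkin intensity with exponents `a` and `b`. The intensities `λ*` and
`λ*_{γ,δ}` both have this form. -/
def moIntensity (a b s t : ℝ) : ℝ := wedgeIntensity b s t + wedgeIntensity a t s

/-- The Marshall–Olkin intensity with exponents `a` and `b` on the diagonal. -/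
def moDiagIntensity (a b s : ℝ) : ℝ := (a + b - 1) * Real.exp (-s)

/-- The exponents of a Marshall–Olkin process, whose off-diagonal and diagonal intensities are
nonnegative and whose mass on `[u, ∞)²` is `exp (-u)`. -/
structure IsMOExponents (a b : ℝ) : Prop where
  left_mem : a ∈ Set.Ioc (0 : ℝ) 1
  right_mem : b ∈ Set.Ioc (0 : ℝ) 1
  one_le_add : 1 ≤ a + b

theorem wedgeIntensity_nonneg {b : ℝ} (hb : b ∈ Set.Icc (0 : ℝ) 1) (s t : ℝ) :
    0 ≤ wedgeIntensity b s t := by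
  have hb₀ := hb.1
  have hb₁ : 0 ≤ 1 - b := sub_nonneg.mpr hb.2
  unfold wedgeIntensity
  split_ifs <;> positivity

theorem measurable_wedgeIntensity (b : ℝ) :
    Measurable fun z : ℝ × ℝ => wedgeIntensity b z.1 z.2 :=
  Measurable.ite (measurableSet_lt measurable_fst measurable_snd) (by fun_prop) measurable_const

theorem measurable_moIntensity (a b : ℝ) :
    Measurable fun z : ℝ × ℝ => moIntensity a b z.1 z.2 :=
  (measurable_wedgeIntensity b).add ((measurable_wedgeIntensity a).comp measurable_swap)

theorem measurable_moDiagIntensity (a b : ℝ) : Measurable (moDiagIntensity a b) := by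
  unfold moDiagIntensity
  fun_prop

theorem lintegral_Ioi_exp_neg_mul {b : ℝ} (hb : 0 < b) (u : ℝ) :
    ∫⁻ t in Set.Ioi u, ENNReal.ofReal (Real.exp (-b * t)) =
      ENNReal.ofReal (Real.exp (-b * u) / b) := by
  rw [← ofReal_integral_eq_lintegral_ofReal (integrableOn_exp_mul_Ioi (neg_lt_zero.mpr hb) u)
    (ae_of_all _ fun t => Real.exp_nonneg _), integral_exp_mul_Ioi (neg_lt_zero.mpr hb),
    neg_div_neg_eq]

theorem lintegral_Ici_const_mul_exp_neg {c : ℝ} (hc : 0 ≤ c) (u : ℝ) :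
    ∫⁻ s in Set.Ici u, ENNReal.ofReal (c * Real.exp (-s)) =
      ENNReal.ofReal (c * Real.exp (-u)) := by
  have hexp := lintegral_Ioi_exp_neg_mul one_pos u
  simp only [neg_mul, one_mul, div_one] at hexp
  simp_rw [ENNReal.ofReal_mul hc]
  rw [lintegral_const_mul _ (by fun_prop), ← restrict_Ioi_eq_restrict_Ici, hexp]

theorem lintegral_Ici_wedgeIntensity {b u s : ℝ} (hb : b ∈ Set.Ioc (0 : ℝ) 1) (hs : u ≤ s) :
    ∫⁻ t in Set.Ici u, ENNReal.ofReal (wedgeIntensity b s t) =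
      ENNReal.ofReal ((1 - b) * Real.exp (-s)) := by
  have hb₀ := hb.1
  have hb₁ : 0 ≤ 1 - b := sub_nonneg.mpr hb.2
  have hind : ∀ t, ENNReal.ofReal (wedgeIntensity b s t) = (Set.Ioi s).indicator (fun t =>
      ENNReal.ofReal (b * (1 - b) * Real.exp (-(1 - b) * s)) *
        ENNReal.ofReal (Real.exp (-b * t))) t := fun t => by
    by_cases hst : s < t
    · rw [Set.indicator_of_mem (Set.mem_Ioi.mpr hst), wedgeIntensity, if_pos hst,
        ENNReal.ofReal_mul (by positivity)]
    · rw [Set.indicator_of_notMem (Set.notMem_Ioi.mpr (not_lt.mp hst)), wedgeIntensity,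
        if_neg hst, ENNReal.ofReal_zero]
  have hexp : Real.exp (-s) = Real.exp (-(1 - b) * s) * Real.exp (-b * s) := by
    rw [← Real.exp_add]
    ring_nf
  simp only [hind]
  rw [lintegral_indicator measurableSet_Ioi, Measure.restrict_restrict measurableSet_Ioi,
    Set.inter_eq_left.mpr (Set.Ioi_subset_Ici hs), lintegral_const_mul _ (by fun_prop),
    lintegral_Ioi_exp_neg_mul hb₀, ← ENNReal.ofReal_mul (by positivity), hexp]
  congr 1
  field_simp

theorem lintegral_wedgeIntensity {b : ℝ} (hb : b ∈ Set.Ioc (0 : ℝ) 1) (u : ℝ) :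
    ∫⁻ s in Set.Ici u, ∫⁻ t in Set.Ici u, ENNReal.ofReal (wedgeIntensity b s t) =
      ENNReal.ofReal ((1 - b) * Real.exp (-u)) := by
  rw [← lintegral_Ici_const_mul_exp_neg (sub_nonneg.mpr hb.2) u]
  exact setLIntegral_congr_fun measurableSet_Ici fun s hs => lintegral_Ici_wedgeIntensity hb hs

theorem lintegral_moIntensity {a b : ℝ} (ha : a ∈ Set.Ioc (0 : ℝ) 1)
    (hb : b ∈ Set.Ioc (0 : ℝ) 1) (u : ℝ) :
    ∫⁻ z in Set.Ici u ×ˢ Set.Ici u, ENNReal.ofReal (moIntensity a b z.1 z.2) =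
      ENNReal.ofReal ((2 - a - b) * Real.exp (-u)) := by
  have hsum : ∀ z : ℝ × ℝ, ENNReal.ofReal (moIntensity a b z.1 z.2) =
      ENNReal.ofReal (wedgeIntensity b z.1 z.2) + ENNReal.ofReal (wedgeIntensity a z.2 z.1) :=
    fun z => ENNReal.ofReal_add (wedgeIntensity_nonneg (Set.Ioc_subset_Icc_self hb) _ _)
      (wedgeIntensity_nonneg (Set.Ioc_subset_Icc_self ha) _ _)
  have hmeas := (measurable_wedgeIntensity b).ennreal_ofReal
  have hmeas' : Measurable fun z : ℝ × ℝ => ENNReal.ofReal (wedgeIntensity a z.2 z.1) :=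
    ((measurable_wedgeIntensity a).comp measurable_swap).ennreal_ofReal
  simp_rw [hsum]
  rw [lintegral_add_left hmeas, Measure.volume_eq_prod, setLIntegral_prod _ hmeas.aemeasurable,
    setLIntegral_prod_symm _ hmeas'.aemeasurable, lintegral_wedgeIntensity hb,
    lintegral_wedgeIntensity ha,
    ← ENNReal.ofReal_add (mul_nonneg (sub_nonneg.mpr hb.2) (Real.exp_nonneg _))
      (mul_nonneg (sub_nonneg.mpr ha.2) (Real.exp_nonneg _))]
  ring_nf

theorem wedgeIntensity_eq_of_lt {s t : ℝ} (hst : s < t) (b : ℝ) :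
    wedgeIntensity b s t = b * (1 - b) * (Real.exp (-s) * Real.exp (-b * (t - s))) := by
  rw [wedgeIntensity, if_pos hst, mul_assoc, ← Real.exp_add, ← Real.exp_add]
  ring_nf

theorem wedgeIntensity_le_add {b β x : ℝ} (hb : 0 ≤ b) (hβ : β ≤ 1) (hbβ : b ≤ β)
    (hxβ : (1 - x) * β ≤ b) (s t : ℝ) :
    wedgeIntensity β s t ≤ wedgeIntensity b s t + x * wedgeIntensity β s t := by
  by_cases hst : s < t
  · have : 0 ≤ 1 - β := sub_nonneg.mpr hβ
    have hb' : 0 ≤ 1 - b := sub_nonneg.mpr (hbβ.trans hβ)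
    have : 0 ≤ t - s := (sub_pos.mpr hst).le
    suffices (1 - x) * wedgeIntensity β s t ≤ wedgeIntensity b s t by linarith
    rw [wedgeIntensity_eq_of_lt hst, wedgeIntensity_eq_of_lt hst]
    calc (1 - x) * (β * (1 - β) * (Real.exp (-s) * Real.exp (-β * (t - s))))
        = (1 - x) * β * (1 - β) * (Real.exp (-s) * Real.exp (-β * (t - s))) := by ring
      _ ≤ b * (1 - b) * (Real.exp (-s) * Real.exp (-b * (t - s))) := by gcongr
  · simp [wedgeIntensity, hst]

end MarshallOlkin

/-! ### Intensity measures on the state space -/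

section IntensityMeasure

variable {n : ℕ}

theorem measurableSet_stateSpace (n : ℕ) :
    MeasurableSet {z : ℝ × ℝ | -Real.log n ≤ z.1 ∧ -Real.log n ≤ z.2} :=
  (measurableSet_le measurable_const measurable_fst).inter
    (measurableSet_le measurable_const measurable_snd)

theorem intensityMeasure_apply (f : ℝ → ℝ → ℝ) (g : ℝ → ℝ) {A B : Set (StateSpace n)}
    (hA : MeasurableSet A) (hB : MeasurableSet B) :
    intensityMeasure f g A B =
      (∫⁻ z in Subtype.val '' (B ∩ A), ENNReal.ofReal (f z.1 z.2)) +
      ∫⁻ s in (fun s : ℝ => (s, s)) ⁻¹' (Subtype.val '' (B ∩ A)), ENNReal.ofReal (g s) := by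
  have hemb : MeasurableEmbedding (Subtype.val : StateSpace n → ℝ × ℝ) :=
    MeasurableEmbedding.subtype_coe (measurableSet_stateSpace n)
  have himage : MeasurableSet (Subtype.val '' (B ∩ A)) :=
    hemb.measurableSet_image.mpr (hB.inter hA)
  have hdiag : Measurable fun s : ℝ => (s, s) := measurable_id.prodMk measurable_id
  rw [intensityMeasure, Measure.restrict_apply hB, hemb.comap_apply, Measure.add_apply,
    withDensity_apply _ himage, Measure.map_apply hdiag himage,
    withDensity_apply _ (hdiag himage)]

theorem intensityMeasure_eq_restrict (f : ℝ → ℝ → ℝ) (g : ℝ → ℝ) (A : Set (StateSpace n)) :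
    intensityMeasure f g A = (intensityMeasure f g Set.univ).restrict A := by
  simp only [intensityMeasure, Measure.restrict_univ]

theorem intensityMeasure_apply_compl (f : ℝ → ℝ → ℝ) (g : ℝ → ℝ) {A : Set (StateSpace n)}
    (hA : MeasurableSet A) : intensityMeasure f g A Aᶜ = 0 := by
  rw [intensityMeasure_eq_restrict, Measure.restrict_apply hA.compl, Set.compl_inter_self,
    measure_empty]

theorem intensityMeasure_le_add {f f₁ f₂ : ℝ → ℝ → ℝ} {g g₁ g₂ : ℝ → ℝ}
    {A : Set (StateSpace n)} (hA : MeasurableSet A)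
    (hf₁ : Measurable fun z : ℝ × ℝ => f₁ z.1 z.2) (hg₁ : Measurable g₁)
    (hf : ∀ s t, f s t ≤ f₁ s t + f₂ s t) (hg : ∀ s, g s ≤ g₁ s + g₂ s) :
    intensityMeasure f g A ≤ intensityMeasure f₁ g₁ A + intensityMeasure f₂ g₂ A := by
  refine Measure.le_iff.mpr fun B hB => ?_
  rw [Measure.add_apply, intensityMeasure_apply _ _ hA hB, intensityMeasure_apply _ _ hA hB,
    intensityMeasure_apply _ _ hA hB, add_add_add_comm,
    ← lintegral_add_left hf₁.ennreal_ofReal, ← lintegral_add_left hg₁.ennreal_ofReal]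
  refine add_le_add (lintegral_mono fun z => ?_) (lintegral_mono fun s => ?_)
  · exact (ENNReal.ofReal_le_ofReal (hf _ _)).trans ENNReal.ofReal_add_le
  · exact (ENNReal.ofReal_le_ofReal (hg _)).trans ENNReal.ofReal_add_le

theorem measurableSet_jointExceedance (n : ℕ) (u : ℝ) : MeasurableSet (jointExceedance n u) := by
  have hval : Measurable fun z : StateSpace n => (z.1.1, z.1.2) := by fun_prop
  exact (measurableSet_le measurable_const hval.fst).inter
    (measurableSet_le measurable_const hval.snd)

theorem image_val_jointExceedance {u : ℝ} (hu : -Real.log n ≤ u) :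
    Subtype.val '' jointExceedance n u = Set.Ici u ×ˢ Set.Ici u := by
  ext z
  constructor
  · rintro ⟨w, hw, rfl⟩
    exact hw
  · exact fun hz => ⟨⟨z, hu.trans hz.1, hu.trans hz.2⟩, hz, rfl⟩

theorem jointExceedance_neg_log (n : ℕ) : jointExceedance n (-Real.log n) = Set.univ :=
  Set.eq_univ_of_forall fun z => z.2

theorem intensityMeasure_jointExceedance (f : ℝ → ℝ → ℝ) (g : ℝ → ℝ) {u : ℝ}
    (hu : -Real.log n ≤ u) :
    intensityMeasure f g (jointExceedance n u) (jointExceedance n u) =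
      (∫⁻ z in Set.Ici u ×ˢ Set.Ici u, ENNReal.ofReal (f z.1 z.2)) +
      ∫⁻ s in Set.Ici u, ENNReal.ofReal (g s) := by
  have hA := measurableSet_jointExceedance n u
  have hdiag : (fun s : ℝ => (s, s)) ⁻¹' (Set.Ici u ×ˢ Set.Ici u) = Set.Ici u := by
    ext s
    simp
  rw [intensityMeasure_apply f g hA hA, Set.inter_self, image_val_jointExceedance hu, hdiag]

theorem intensityMeasure_moIntensity_jointExceedance {a b : ℝ} (hab : IsMOExponents a b)
    {u : ℝ} (hu : -Real.log n ≤ u) :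
    intensityMeasure (moIntensity a b) (moDiagIntensity a b) (jointExceedance n u)
      (jointExceedance n u) = ENNReal.ofReal (Real.exp (-u)) := by
  have hoff : 0 ≤ 2 - a - b := by linarith [hab.left_mem.2, hab.right_mem.2]
  have hdiag : 0 ≤ a + b - 1 := sub_nonneg.mpr hab.one_le_add
  rw [intensityMeasure_jointExceedance _ _ hu, lintegral_moIntensity hab.left_mem hab.right_mem]
  unfold moDiagIntensity
  rw [lintegral_Ici_const_mul_exp_neg hdiag, ← ENNReal.ofReal_add (by positivity) (by positivity)]
  ring_nf

theorem isFiniteMeasure_intensityMeasure_moIntensity {a b : ℝ} (hab : IsMOExponents a b)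
    (A : Set (StateSpace n)) :
    IsFiniteMeasure (intensityMeasure (moIntensity a b) (moDiagIntensity a b) A) := by
  have hmass := intensityMeasure_moIntensity_jointExceedance (n := n) hab le_rfl
  rw [jointExceedance_neg_log] at hmass
  have : IsFiniteMeasure
      (intensityMeasure (n := n) (moIntensity a b) (moDiagIntensity a b) Set.univ) :=
    ⟨hmass.trans_lt ENNReal.ofReal_lt_top⟩
  rw [intensityMeasure_eq_restrict]
  infer_instance

end IntensityMeasure

/-! ### Comparison of Marshall–Olkin intensity measures -/

section Comparison

variable {n : ℕ}

theorem intensityMeasure_moIntensity_le_add {a b α β x : ℝ} (hab : IsMOExponents a b)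
    (hαβ : IsMOExponents α β) (ha : a ∈ Set.Icc ((1 - x) * α) α)
    (hb : b ∈ Set.Icc ((1 - x) * β) β) {A : Set (StateSpace n)} (hA : MeasurableSet A) :
    intensityMeasure (moIntensity α β) (moDiagIntensity α β) A ≤
      intensityMeasure (moIntensity a b) (moDiagIntensity a b) A +
        intensityMeasure (fun s t => x * moIntensity α β s t)
          (fun s => x * (α + β) * Real.exp (-s)) A := by
  refine intensityMeasure_le_add hA (measurable_moIntensity a b) (measurable_moDiagIntensity a b)
    (fun s t => ?_) fun s => ?_
  · unfold moIntensity
    linarith [wedgeIntensity_le_add hab.right_mem.1.le hαβ.right_mem.2 hb.2 hb.1 s t,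
      wedgeIntensity_le_add hab.left_mem.1.le hαβ.left_mem.2 ha.2 ha.1 t s]
  · unfold moDiagIntensity
    rw [← add_mul]
    exact mul_le_mul_of_nonneg_right (by linarith [ha.1, hb.1]) (Real.exp_nonneg _)

theorem intensityMeasure_mul_moIntensity_jointExceedance {α β x : ℝ}
    (hα : α ∈ Set.Ioc (0 : ℝ) 1) (hβ : β ∈ Set.Ioc (0 : ℝ) 1) (hx : 0 ≤ x) {u : ℝ}
    (hu : -Real.log n ≤ u) :
    intensityMeasure (fun s t => x * moIntensity α β s t)
      (fun s => x * (α + β) * Real.exp (-s)) (jointExceedance n u) (jointExceedance n u) =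
        ENNReal.ofReal (2 * x * Real.exp (-u)) := by
  have hoff : 0 ≤ 2 - α - β := by linarith [hα.2, hβ.2]
  have hdiag : 0 ≤ x * (α + β) := mul_nonneg hx (add_pos hα.1 hβ.1).le
  rw [intensityMeasure_jointExceedance _ _ hu, lintegral_Ici_const_mul_exp_neg hdiag]
  simp_rw [ENNReal.ofReal_mul hx]
  rw [lintegral_const_mul _ (measurable_moIntensity α β).ennreal_ofReal,
    lintegral_moIntensity hα hβ, ← ENNReal.ofReal_mul hx,
    ← ENNReal.ofReal_add (by positivity) (by positivity)]
  ring_nf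

theorem absDiff_moIntensity_jointExceedance_le {a b α β x u : ℝ} (hab : IsMOExponents a b)
    (hαβ : IsMOExponents α β) (hx : 0 ≤ x) (ha : a ∈ Set.Icc ((1 - x) * α) α)
    (hb : b ∈ Set.Icc ((1 - x) * β) β) (hu : -Real.log n ≤ u) :
    absDiff (intensityMeasure (moIntensity a b) (moDiagIntensity a b) (jointExceedance n u))
      (intensityMeasure (moIntensity α β) (moDiagIntensity α β) (jointExceedance n u))
      (jointExceedance n u) ≤ ENNReal.ofReal (4 * x * Real.exp (-u)) := by
  have := isFiniteMeasure_intensityMeasure_moIntensity hab (jointExceedance n u)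
  have := isFiniteMeasure_intensityMeasure_moIntensity hαβ (jointExceedance n u)
  have hmass := (intensityMeasure_moIntensity_jointExceedance hab hu).trans
    (intensityMeasure_moIntensity_jointExceedance hαβ hu).symm
  refine (absDiff_apply_le_two_mul hmass <| intensityMeasure_moIntensity_le_add hab hαβ ha hb
    (measurableSet_jointExceedance n u)).trans_eq ?_
  rw [intensityMeasure_mul_moIntensity_jointExceedance hαβ.left_mem hαβ.right_mem hx hu, two_mul,
    ← ENNReal.ofReal_add (by positivity) (by positivity)]
  ring_nf

end Comparison

/-! ### The two mean measures -/

section Exponents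

theorem log_div_log_mem_Ioc {x y : ℝ} (hx : 0 < x) (hxy : x ≤ y) (hy : y < 1) :
    Real.log y / Real.log x ∈ Set.Ioc (0 : ℝ) 1 := by
  have hlogx : Real.log x < 0 := Real.log_neg hx (hxy.trans_lt hy)
  have hlogy : Real.log y < 0 := Real.log_neg (hx.trans_le hxy) hy
  exact ⟨div_pos_of_neg_of_neg hlogy hlogx,
    (div_le_one_of_neg hlogx).mpr (Real.log_le_log hx hxy)⟩

theorem log_div_div_log {x y : ℝ} (hy : y ≠ 0) (hx : Real.log x ≠ 0) :
    Real.log (x / y) / Real.log x = 1 - Real.log y / Real.log x := by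
  rw [Real.log_div (Real.log_ne_zero.mp hx).1 hy, sub_div, div_self hx]

theorem log_div_mul_log_div_log_one_div_sq {x y : ℝ} (hy : y ≠ 0) (hx : Real.log x ≠ 0) :
    Real.log (x / y) * Real.log y / Real.log (1 / x) ^ 2 =
      Real.log y / Real.log x * (1 - Real.log y / Real.log x) := by
  rw [← log_div_div_log hy hx, one_div, Real.log_inv]
  field_simp

theorem one_sub_mul_le_log_div_log {x α : ℝ} (hx₀ : 0 < x) (hx₁ : x < 1) (hα₀ : 0 ≤ α)
    (hα₁ : α ≤ 1) : (1 - x) * α ≤ Real.log (1 - α * x) / Real.log (1 - x) := by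
  have hx : 0 < 1 - x := sub_pos.mpr hx₁
  have hαx : 0 < 1 - α * x := sub_pos.mpr ((mul_le_of_le_one_left hx₀.le hα₁).trans_lt hx₁)
  have hlog : -x ≤ (1 - x) * Real.log (1 - x) :=
    calc -x = (1 - x) * (1 - (1 - x)⁻¹) := by field_simp; ring
      _ ≤ (1 - x) * Real.log (1 - x) := by gcongr; exact Real.one_sub_inv_le_log_of_pos hx
  rw [le_div_iff_of_neg (Real.log_neg hx (by linarith))]
  calc Real.log (1 - α * x) ≤ α * -x := by linarith [Real.log_le_sub_one_of_pos hαx]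
    _ ≤ α * ((1 - x) * Real.log (1 - x)) := by gcongr
    _ = (1 - x) * α * Real.log (1 - x) := by ring

theorem log_div_log_le {x α : ℝ} (hx₀ : 0 < x) (hx₁ : x < 1) (hα₀ : 0 ≤ α) (hα₁ : α ≤ 1) :
    Real.log (1 - α * x) / Real.log (1 - x) ≤ α := by
  have hx : 0 < 1 - x := sub_pos.mpr hx₁
  rw [div_le_iff_of_neg (Real.log_neg hx (by linarith)), ← Real.log_rpow hx]
  refine Real.log_le_log (Real.rpow_pos_of_pos hx α) ?_
  have hbernoulli := rpow_one_add_le_one_add_mul_self (s := -x) (by linarith) hα₀ hα₁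
  rwa [← sub_eq_add_neg, mul_neg, ← sub_eq_add_neg] at hbernoulli

namespace BernoulliPair

variable (p : BernoulliPair)

/-- The exponent `log q₁ / log p₀₀` of the intensity `λ*`. -/
def exponent1 : ℝ := Real.log p.q1 / Real.log p.p00

/-- The exponent `log q₂ / log p₀₀` of the intensity `λ*`. -/
def exponent2 : ℝ := Real.log p.q2 / Real.log p.p00

theorem p00_le_q1 : p.p00 ≤ p.q1 := le_add_of_nonneg_right p.p01_nonneg

theorem p00_le_q2 : p.p00 ≤ p.q2 := le_add_of_nonneg_right p.p10_nonneg

theorem isMOExponents (hp00 : 0 < p.p00) (hq1 : p.q1 < 1) (hq2 : p.q2 < 1)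
    (hq : p.q1 * p.q2 ≤ p.p00) : IsMOExponents p.exponent1 p.exponent2 where
  left_mem := log_div_log_mem_Ioc hp00 p.p00_le_q1 hq1
  right_mem := log_div_log_mem_Ioc hp00 p.p00_le_q2 hq2
  one_le_add := by
    have hq1₀ : 0 < p.q1 := hp00.trans_le p.p00_le_q1
    have hq2₀ : 0 < p.q2 := hp00.trans_le p.p00_le_q2
    have hlog : Real.log p.p00 < 0 := Real.log_neg hp00 (p.p00_le_q1.trans_lt hq1)
    rw [exponent1, exponent2, ← add_div, one_le_div_of_neg hlog,
      ← Real.log_mul hq1₀.ne' hq2₀.ne']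
    exact Real.log_le_log (mul_pos hq1₀ hq2₀) hq

variable {p}

theorem intensity_eq_moIntensity (hp₀ : 0 < p.p00) (hp₁ : p.p00 < 1) :
    p.intensity = moIntensity p.exponent1 p.exponent2 := by
  have hq1 : p.q1 ≠ 0 := (hp₀.trans_le p.p00_le_q1).ne'
  have hq2 : p.q2 ≠ 0 := (hp₀.trans_le p.p00_le_q2).ne'
  have hlog : Real.log p.p00 ≠ 0 := (Real.log_neg hp₀ hp₁).ne
  funext s t
  unfold intensity moIntensity wedgeIntensity exponent1 exponent2
  rw [log_div_mul_log_div_log_one_div_sq hq1 hlog, log_div_mul_log_div_log_one_div_sq hq2 hlog,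
    log_div_div_log hq1 hlog, log_div_div_log hq2 hlog]
  rcases lt_trichotomy s t with hst | rfl | hts
  · rw [if_pos hst, if_pos hst, if_neg hst.not_gt, add_zero]
  · simp
  · rw [if_neg hts.not_gt, if_pos hts, if_neg hts.not_gt, if_pos hts, zero_add, mul_right_comm]

theorem diagIntensity_eq_moDiagIntensity (hp₀ : 0 < p.p00) (hp₁ : p.p00 < 1) :
    p.diagIntensity = moDiagIntensity p.exponent1 p.exponent2 := by
  have hq1 : p.q1 ≠ 0 := (hp₀.trans_le p.p00_le_q1).ne'
  have hq2 : p.q2 ≠ 0 := (hp₀.trans_le p.p00_le_q2).ne'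
  have hlog : Real.log p.p00 ≠ 0 := (Real.log_neg hp₀ hp₁).ne
  funext s
  unfold diagIntensity moDiagIntensity exponent1 exponent2
  rw [Real.log_div hp₀.ne' (mul_ne_zero hq1 hq2), Real.log_mul hq1 hq2, one_div, Real.log_inv]
  congr 1
  field_simp
  ring

end BernoulliPair

/-- The exponent `(1 + γ) / (1 + γ + δ)` of the intensity `λ*_{γ,δ}`; its other exponent
`(1 + δ) / (1 + γ + δ)` is `limitExponent δ γ`. -/
def limitExponent (γ δ : ℝ) : ℝ := (1 + γ) / (1 + γ + δ)

theorem limitExponent_swap (γ δ : ℝ) : limitExponent δ γ = (1 + δ) / (1 + γ + δ) := by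
  rw [limitExponent, add_right_comm]

variable {γ δ : ℝ}

theorem limitExponent_mem_Ioc (hγ : 0 ≤ γ) (hδ : 0 ≤ δ) :
    limitExponent γ δ ∈ Set.Ioc (0 : ℝ) 1 :=
  ⟨by unfold limitExponent; positivity, (div_le_one (by positivity)).mpr (by linarith)⟩

theorem isMOExponents_limitExponent (hγ : 0 ≤ γ) (hδ : 0 ≤ δ) :
    IsMOExponents (limitExponent γ δ) (limitExponent δ γ) where
  left_mem := limitExponent_mem_Ioc hγ hδ
  right_mem := limitExponent_mem_Ioc hδ hγ
  one_le_add := by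
    rw [limitExponent_swap, limitExponent, ← add_div, one_le_div (by positivity)]
    linarith

theorem limitIntensity_eq_moIntensity (hγ : 0 ≤ γ) (hδ : 0 ≤ δ) :
    limitIntensity γ δ = moIntensity (limitExponent γ δ) (limitExponent δ γ) := by
  have hleft : 1 - (1 + γ) / (1 + γ + δ) = δ / (1 + γ + δ) := by field_simp; ring
  have hright : 1 - (1 + δ) / (1 + γ + δ) = γ / (1 + γ + δ) := by field_simp; ring
  funext s t
  rw [limitExponent_swap γ δ]
  unfold limitIntensity moIntensity wedgeIntensity limitExponent
  rw [hleft, hright]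
  rcases lt_trichotomy s t with hst | rfl | hts
  · rw [if_pos hst, if_pos hst, if_neg hst.not_gt, add_zero]
    congr 2
    field_simp
  · simp
  · rw [if_neg hts.not_gt, if_pos hts, if_neg hts.not_gt, if_pos hts, zero_add, mul_right_comm]
    congr 2
    field_simp

theorem limitDiagIntensity_eq_moDiagIntensity (hγ : 0 ≤ γ) (hδ : 0 ≤ δ) :
    limitDiagIntensity γ δ = moDiagIntensity (limitExponent γ δ) (limitExponent δ γ) := by
  funext s
  rw [limitExponent_swap γ δ]
  unfold limitDiagIntensity moDiagIntensity limitExponent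
  congr 1
  field_simp
  ring

end Exponents

section MeanMeasures

variable {n : ℕ} {p : BernoulliPair} {γ δ : ℝ}

theorem meanMeasure_eq_intensityMeasure (hp₀ : 0 < p.p00) (hp₁ : p.p00 < 1)
    (A : Set (StateSpace n)) :
    meanMeasure p A = intensityMeasure (moIntensity p.exponent1 p.exponent2)
      (moDiagIntensity p.exponent1 p.exponent2) A := by
  rw [meanMeasure, BernoulliPair.intensity_eq_moIntensity hp₀ hp₁,
    BernoulliPair.diagIntensity_eq_moDiagIntensity hp₀ hp₁]

theorem limitMeasure_eq_intensityMeasure (hγ : 0 ≤ γ) (hδ : 0 ≤ δ) (A : Set (StateSpace n)) :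
    limitMeasure γ δ A = intensityMeasure (moIntensity (limitExponent γ δ) (limitExponent δ γ))
      (moDiagIntensity (limitExponent γ δ) (limitExponent δ γ)) A := by
  rw [limitMeasure, limitIntensity_eq_moIntensity hγ hδ,
    limitDiagIntensity_eq_moDiagIntensity hγ hδ]

theorem isFiniteMeasure_meanMeasure (hp00 : 0 < p.p00) (hq1 : p.q1 < 1) (hq2 : p.q2 < 1)
    (hq : p.q1 * p.q2 ≤ p.p00) (A : Set (StateSpace n)) : IsFiniteMeasure (meanMeasure p A) := by
  rw [meanMeasure_eq_intensityMeasure hp00 (p.p00_le_q1.trans_lt hq1)]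
  exact isFiniteMeasure_intensityMeasure_moIntensity (p.isMOExponents hp00 hq1 hq2 hq) A

theorem isFiniteMeasure_limitMeasure (hγ : 0 ≤ γ) (hδ : 0 ≤ δ) (A : Set (StateSpace n)) :
    IsFiniteMeasure (limitMeasure γ δ A) := by
  rw [limitMeasure_eq_intensityMeasure hγ hδ]
  exact isFiniteMeasure_intensityMeasure_moIntensity (isMOExponents_limitExponent hγ hδ) A

theorem meanMeasure_jointExceedance (hp00 : 0 < p.p00) (hq1 : p.q1 < 1) (hq2 : p.q2 < 1)
    (hq : p.q1 * p.q2 ≤ p.p00) {u : ℝ} (hu : -Real.log n ≤ u) :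
    meanMeasure p (jointExceedance n u) (jointExceedance n u) =
      ENNReal.ofReal (Real.exp (-u)) := by
  rw [meanMeasure_eq_intensityMeasure hp00 (p.p00_le_q1.trans_lt hq1)]
  exact intensityMeasure_moIntensity_jointExceedance (p.isMOExponents hp00 hq1 hq2 hq) hu

theorem limitMeasure_jointExceedance (hγ : 0 ≤ γ) (hδ : 0 ≤ δ) {u : ℝ} (hu : -Real.log n ≤ u) :
    limitMeasure γ δ (jointExceedance n u) (jointExceedance n u) =
      ENNReal.ofReal (Real.exp (-u)) := by
  rw [limitMeasure_eq_intensityMeasure hγ hδ]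
  exact intensityMeasure_moIntensity_jointExceedance (isMOExponents_limitExponent hγ hδ) hu

end MeanMeasures

theorem d0_mem_Icc {n : ℕ} (z w : StateSpace n) : d0 z w ∈ Set.Icc (0 : ℝ) 1 :=
  ⟨le_min zero_le_one (Real.sqrt_nonneg _), min_le_left _ _⟩

theorem d0_self {n : ℕ} (z : StateSpace n) : d0 z z = 0 := by
  simp [d0]

/-! ### Joint threshold exceedances -/

section JointExceedance

variable {p : BernoulliPair} {γ δ : ℝ}

namespace BernoulliPair

theorem p00_eq (h10 : p.p10 = γ * p.p11) (h01 : p.p01 = δ * p.p11) :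
    p.p00 = 1 - (1 + γ + δ) * p.p11 := by
  linarith [p.sum_eq_one]

theorem q1_eq (hγ : 0 ≤ γ) (hδ : 0 ≤ δ) (h10 : p.p10 = γ * p.p11) (h01 : p.p01 = δ * p.p11) :
    p.q1 = 1 - limitExponent γ δ * ((1 + γ + δ) * p.p11) := by
  rw [q1, p00_eq h10 h01, h01, limitExponent]
  field_simp
  ring

theorem q2_eq (hγ : 0 ≤ γ) (hδ : 0 ≤ δ) (h10 : p.p10 = γ * p.p11) (h01 : p.p01 = δ * p.p11) :
    p.q2 = 1 - limitExponent δ γ * ((1 + γ + δ) * p.p11) := by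
  rw [q2, p00_eq h10 h01, h10, limitExponent_swap γ δ]
  field_simp
  ring

theorem exponent1_mem_Icc (hp₀ : 0 < p.p00) (hp₁ : p.p00 < 1) (hγ : 0 ≤ γ) (hδ : 0 ≤ δ)
    (h10 : p.p10 = γ * p.p11) (h01 : p.p01 = δ * p.p11) :
    p.exponent1 ∈ Set.Icc (p.p00 * limitExponent γ δ) (limitExponent γ δ) := by
  obtain ⟨hα₀, hα₁⟩ := limitExponent_mem_Ioc hγ hδ
  rw [exponent1, q1_eq hγ hδ h10 h01, p00_eq h10 h01]
  rw [p00_eq h10 h01] at hp₀ hp₁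
  exact ⟨one_sub_mul_le_log_div_log (by linarith) (by linarith) hα₀.le hα₁,
    log_div_log_le (by linarith) (by linarith) hα₀.le hα₁⟩

theorem exponent2_mem_Icc (hp₀ : 0 < p.p00) (hp₁ : p.p00 < 1) (hγ : 0 ≤ γ) (hδ : 0 ≤ δ)
    (h10 : p.p10 = γ * p.p11) (h01 : p.p01 = δ * p.p11) :
    p.exponent2 ∈ Set.Icc (p.p00 * limitExponent δ γ) (limitExponent δ γ) := by
  obtain ⟨hβ₀, hβ₁⟩ := limitExponent_mem_Ioc hδ hγ
  rw [exponent2, q2_eq hγ hδ h10 h01, p00_eq h10 h01]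
  rw [p00_eq h10 h01] at hp₀ hp₁
  exact ⟨one_sub_mul_le_log_div_log (by linarith) (by linarith) hβ₀.le hβ₁,
    log_div_log_le (by linarith) (by linarith) hβ₀.le hβ₁⟩

end BernoulliPair

theorem four_mul_le_four_mul_sq_mul_div {θ r : ℝ} (hθ : 1 ≤ θ) (hr : 0 ≤ r) (hθr : θ * r < 1) :
    4 * (θ * r) ≤ 4 * θ ^ 2 * r / (1 - θ * r) ^ 3 := by
  have hθr₀ : 0 ≤ θ * r := by positivity
  calc 4 * (θ * r) = 4 * (1 * θ * r) := by rw [one_mul]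
    _ ≤ 4 * (θ * θ * r) := by gcongr
    _ = 4 * θ ^ 2 * r := by ring
    _ ≤ 4 * θ ^ 2 * r / (1 - θ * r) ^ 3 :=
      le_div_self (by positivity) (pow_pos (by linarith) 3)
        (pow_le_one₀ (by linarith) (by linarith))

variable {n : ℕ} {u : ℝ}

theorem absDiff_meanMeasure_limitMeasure_jointExceedance_le (hp00 : 0 < p.p00) (hq1 : p.q1 < 1)
    (hq2 : p.q2 < 1) (hq : p.q1 * p.q2 ≤ p.p00) (hγ : 0 ≤ γ) (hδ : 0 ≤ δ)
    (h10 : p.p10 = γ * p.p11) (h01 : p.p01 = δ * p.p11) (hu : -Real.log n ≤ u) :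
    absDiff (meanMeasure p (jointExceedance n u)) (limitMeasure γ δ (jointExceedance n u))
      (jointExceedance n u) ≤ ENNReal.ofReal (4 * (1 + γ + δ) ^ 2 * p.p11 /
        (1 - (1 + γ + δ) * p.p11) ^ 3 * Real.exp (-u)) := by
  have hp₁ : p.p00 < 1 := p.p00_le_q1.trans_lt hq1
  have hp : 1 - (1 + γ + δ) * p.p11 = p.p00 := (BernoulliPair.p00_eq h10 h01).symm
  rw [meanMeasure_eq_intensityMeasure hp00 hp₁, limitMeasure_eq_intensityMeasure hγ hδ]
  refine (absDiff_moIntensity_jointExceedance_le (x := (1 + γ + δ) * p.p11)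
    (p.isMOExponents hp00 hq1 hq2 hq) (isMOExponents_limitExponent hγ hδ)
    (mul_nonneg (by positivity) p.p11_nonneg) ?_ ?_ hu).trans (ENNReal.ofReal_le_ofReal ?_)
  · rw [hp]
    exact BernoulliPair.exponent1_mem_Icc hp00 hp₁ hγ hδ h10 h01
  · rw [hp]
    exact BernoulliPair.exponent2_mem_Icc hp00 hp₁ hγ hδ h10 h01
  · gcongr
    exact four_mul_le_four_mul_sq_mul_div (by linarith) p.p11_nonneg (by linarith)

theorem steinFactor_exp_neg (u : ℝ) :
    steinFactor (ENNReal.ofReal (Real.exp (-u))) (ENNReal.ofReal (Real.exp (-u))) =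
      ENNReal.ofReal (min 1 (1.65 * Real.exp (u / 2))) := by
  rw [steinFactor, min_self, ENNReal.ofReal_rpow_of_pos (Real.exp_pos _), ← Real.exp_mul,
    ← ENNReal.ofReal_mul (by norm_num), ← ENNReal.ofReal_one, ← ENNReal.ofReal_min]
  ring_nf

theorem steinFactor_exp_neg_mul (u c : ℝ) :
    steinFactor (ENNReal.ofReal (Real.exp (-u))) (ENNReal.ofReal (Real.exp (-u))) *
        ENNReal.ofReal (c * Real.exp (-u)) =
      ENNReal.ofReal (min (Real.exp (-u)) (1.65 * Real.exp (-u / 2)) * c) := by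
  have hexp : Real.exp (u / 2) * Real.exp (-u) = Real.exp (-u / 2) := by
    rw [← Real.exp_add]
    ring_nf
  rw [steinFactor_exp_neg, ← ENNReal.ofReal_mul (by positivity), mul_comm c, ← mul_assoc,
    min_mul_of_nonneg _ _ (Real.exp_nonneg _), one_mul, mul_assoc, hexp]

theorem steinFactor_mul_absDiff_jointExceedance_le (hp00 : 0 < p.p00) (hq1 : p.q1 < 1)
    (hq2 : p.q2 < 1) (hq : p.q1 * p.q2 ≤ p.p00) (hγ : 0 ≤ γ) (hδ : 0 ≤ δ)
    (h10 : p.p10 = γ * p.p11) (h01 : p.p01 = δ * p.p11) (hu : -Real.log n ≤ u) :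
    steinFactor (meanMeasure p (jointExceedance n u) (jointExceedance n u))
        (limitMeasure γ δ (jointExceedance n u) (jointExceedance n u)) *
      absDiff (meanMeasure p (jointExceedance n u)) (limitMeasure γ δ (jointExceedance n u))
        (jointExceedance n u) ≤
      ENNReal.ofReal (min (Real.exp (-u)) (1.65 * Real.exp (-u / 2)) *
        (4 * (1 + γ + δ) ^ 2 * p.p11 / (1 - (1 + γ + δ) * p.p11) ^ 3)) := by
  rw [meanMeasure_jointExceedance hp00 hq1 hq2 hq hu, limitMeasure_jointExceedance hγ hδ hu,
    ← steinFactor_exp_neg_mul]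
  gcongr
  exact absDiff_meanMeasure_limitMeasure_jointExceedance_le hp00 hq1 hq2 hq hγ hδ h10 h01 hu

end JointExceedance

end

theorem theoremt (n : ℕ) (hn : 1 ≤ n) (p : BernoulliPair) (hp00 : 0 < p.p00)
    (hq1 : p.q1 < 1) (hq2 : p.q2 < 1) (hq : p.q1 * p.q2 ≤ p.p00)
    (γ δ : ℝ) (hγ : 0 < γ) (hδ : 0 < δ) :
    -- arbitrary Borel sets
    (∀ A : Set (StateSpace n), MeasurableSet A →
      ∀ P Q : Measure (PointMeasure (StateSpace n)),
        IsPRM (meanMeasure p A) P → IsPRM (limitMeasure γ δ A) Q →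
        dTV P Q ≤ absDiff (meanMeasure p A) (limitMeasure γ δ A) A ∧
        d2 d0 P Q ≤ steinFactor (meanMeasure p A A) (limitMeasure γ δ A A) *
          absDiff (meanMeasure p A) (limitMeasure γ δ A) A) ∧
    -- joint threshold exceedances
    (p.p10 = γ * p.p11 → p.p01 = δ * p.p11 →
      ∀ u : ℝ, -Real.log n ≤ u → ∀ A : Set (StateSpace n), A = jointExceedance n u →
        absDiff (meanMeasure p A) (limitMeasure γ δ A) A ≤
          ENNReal.ofReal (4 * (1 + γ + δ) ^ 2 * p.p11 / (1 - (1 + γ + δ) * p.p11) ^ 3 *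
            Real.exp (-u)) ∧
        steinFactor (meanMeasure p A A) (limitMeasure γ δ A A) *
            absDiff (meanMeasure p A) (limitMeasure γ δ A) A ≤
          ENNReal.ofReal (min (Real.exp (-u)) (1.65 * Real.exp (-u / 2)) *
            (4 * (1 + γ + δ) ^ 2 * p.p11 / (1 - (1 + γ + δ) * p.p11) ^ 3)) ∧
        ∀ P Q : Measure (PointMeasure (StateSpace n)),
          IsPRM (meanMeasure p A) P → IsPRM (limitMeasure γ δ A) Q →
          dTV P Q ≤
            ENNReal.ofReal (4 * (1 + γ + δ) ^ 2 * p.p11 / (1 - (1 + γ + δ) * p.p11) ^ 3 *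
              Real.exp (-u)) ∧
          d2 d0 P Q ≤
            ENNReal.ofReal (min (Real.exp (-u)) (1.65 * Real.exp (-u / 2)) *
              (4 * (1 + γ + δ) ^ 2 * p.p11 / (1 - (1 + γ + δ) * p.p11) ^ 3))) := by
  have := isFiniteMeasure_meanMeasure (n := n) hp00 hq1 hq2 hq
  have := isFiniteMeasure_limitMeasure (n := n) hγ.le hδ.le
  have hbounds {A : Set (StateSpace n)} (hA : MeasurableSet A)
      {P Q : Measure (PointMeasure (StateSpace n))} (hP : IsPRM (meanMeasure p A) P)
      (hQ : IsPRM (limitMeasure γ δ A) Q) :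
      dTV P Q ≤ absDiff (meanMeasure p A) (limitMeasure γ δ A) A ∧
        d2 d0 P Q ≤ steinFactor (meanMeasure p A A) (limitMeasure γ δ A A) *
          absDiff (meanMeasure p A) (limitMeasure γ δ A) A :=
    have hmean : meanMeasure p A Aᶜ = 0 := intensityMeasure_apply_compl _ _ hA
    have hlimit : limitMeasure γ δ A Aᶜ = 0 := intensityMeasure_apply_compl _ _ hA
    ⟨hP.dTV_le_of_apply_compl_eq_zero hA hmean hlimit hQ,
      hP.d2_le_of_apply_compl_eq_zero d0_mem_Icc d0_self hA hmean hlimit hQ⟩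
  refine ⟨fun A hA P Q => hbounds hA, ?_⟩
  rintro h10 h01 u hu A rfl
  have hA := measurableSet_jointExceedance n u
  have hvar := absDiff_meanMeasure_limitMeasure_jointExceedance_le hp00 hq1 hq2 hq hγ.le hδ.le
    h10 h01 hu
  have hstein := steinFactor_mul_absDiff_jointExceedance_le hp00 hq1 hq2 hq hγ.le hδ.le h10 h01 hu
  exact ⟨hvar, hstein, fun P Q hP hQ =>
    ⟨(hbounds hA hP hQ).1.trans hvar, (hbounds hA hP hQ).2.trans hstein⟩⟩
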